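/- Let $\mathfrak a\in\mathbb{R}\setminus\{0\}$, $\gamma\in\mathbb{R}$, and let $\theta:[0,\infty)\to\mathbb{R}$ be a measurable function with compact support such that, for some $b>0$, $1-\frac sb\le\theta(s)\le 1+\frac sb$ for all $s\ge 0$. Let $\hat{\ }$ denote the unitary Fourier transform, $\hat u(p)=(2\pi)^{-d/2}\int_{\mathbb{R}^d}e^{-ip\cdot x}u(x)\,dx$. Let $$L^2_{\mathrm{sym}}(\mathbb{R}^6)=\{\psi\in L^2(\mathbb{R}^6):\ \psi(x,y)=\psi(-x,y)=\psi(\tfrac12x+y,\tfrac34x-\tfrac12y)\},\qquad x,y\in\mathbb{R}^3,$$ and $\mathcal H_0=-\Delta_x-\frac34\Delta_y$. For $\lambda>0$ and $\xi\in L^2(\mathbb{R}^3)$ define $G(-\lambda)\xi\in L^2_{\mathrm{sym}}(\mathbb{R}^6)$ by $$\widehat{G(-\lambda)\xi}(k,p)=\sqrt{\tfrac2\pi}\;\frac{\hat\xi(p)+\hat\xi(k-\frac12p)+\hat\xi(-k-\frac12p)}{|k|^2+\frac34|p|^2+\lambda},$$ and for $\xi\in H^{1/2}(\mathbb{R}^3)$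 set $$\begin{aligned}\Phi^\lambda[\xi]={}&12\pi\int_{\mathbb{R}^3}\sqrt{\tfrac34|p|^2+\lambda}\,|\hat\xi(p)|^2dp-\frac{12}{\pi}\int_{\mathbb{R}^6}\frac{\overline{\hat\xi(p)}\,\hat\xi(q)}{|p|^2+|q|^2+p\cdot q+\lambda}\,dp\,dq\\&+\frac{6\gamma}{\pi}\int_{\mathbb{R}^6}\frac{\overline{\hat\xi(p)}\,\hat\xi(q)}{|p-q|^2}\,dp\,dq+12\pi\int_{\mathbb{R}^3}\Big(-\frac1{\mathfrak a}+\gamma\,\frac{\theta(|y|)-1}{|y|}\Big)|\xi(y)|^2dy.\end{aligned}$$ Let $Q$ be the quadratic form whose domain consists of the $\psi\in L^2_{\mathrm{sym}}(\mathbb{R}^6)$ that can be written as $\psi=\phi_\lambda+G(-\lambda)\xi$ with $\phi_\lambda\in H^1(\mathbb{R}^6)$ and $\xi\in H^{1/2}(\mathbb{R}^3)$, with $$Q[\psi]=\|\mathcal H_0^{1/2}\phi_\lambda\|^2+\lambda\|\phi_\lambda\|^2-\lambda\|\psi\|^2+\Phi^\lambda[\xi].$$ Let $\gamma_c=\frac43-\frac{\sqrt3}{\pi}$.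 If $\gamma<\gamma_c$, then $Q$, computed with any $\lambda>0$, is unbounded from below: there is no $m\in\mathbb{R}$ such that $Q[\psi]\ge m\|\psi\|^2$ for all $\psi$ in its domain. -/

import Mathlib

noncomputable section

namespace ThreeBosons

open MeasureTheory FourierTransform
open scoped NNReal SchwartzMap

/-- Physical space `ℝ³` with its Euclidean norm and Lebesgue measure. -/
abbrev R3 : Type := EuclideanSpace ℝ (Fin 3)

/-- The configuration space `ℝ⁶ = ℝ³ × ℝ³` of the Jacobi coordinates `(x, y)`, with its Euclidean
norm and Lebesgue measure. A point of it is `(z.fst, z.snd)`; the same space carries the conjugate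
momenta `(k, p)`. -/
abbrev R6 : Type := WithLp 2 (R3 × R3)

/-- `L²(V)`, complex-valued, with respect to Lebesgue measure. -/
abbrev L2 (V : Type) [NormedAddCommGroup V] [InnerProductSpace ℝ V] [FiniteDimensional ℝ V]
    [MeasurableSpace V] [BorelSpace V] : Type :=
  Lp ℂ 2 (volume : Measure V)

section Fourier

variable {V : Type} [NormedAddCommGroup V] [InnerProductSpace ℝ V] [FiniteDimensional ℝ V]
  [MeasurableSpace V] [BorelSpace V]

/-- The unitary Fourier transform on `L²(V)`,
`û(p) = (2π)^(-d/2) ∫ exp(-i p·x) u(x) dx` with `d = dim V`, written through Mathlib's `L²` Fourier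
transform, which uses the phase `exp(-2π i p·x)`. -/
def hat (u : L2 V) (p : V) : ℂ :=
  (((2 * Real.pi) ^ (-(Module.finrank ℝ V : ℝ) / 2) : ℝ) : ℂ) * (𝓕 u : L2 V) ((2 * Real.pi)⁻¹ • p)

/-- `u ∈ L²(V)` belongs to the Sobolev space `H^s(V)`. -/
def MemH (s : ℝ) (u : L2 V) : Prop :=
  TemperedDistribution.MemSobolev s 2 (u : 𝓢'(V, ℂ))

end Fourier

/-- The bosonic symmetry defining `L²_sym(ℝ⁶)`: invariance under the exchange of particles `2, 3`
and of particles `1, 2`. -/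
def IsSymmetric (ψ : L2 R6) : Prop :=
  (∀ᵐ z : R6, ψ z = ψ (WithLp.toLp 2 (-z.fst, z.snd))) ∧
  (∀ᵐ z : R6, ψ z = ψ (WithLp.toLp 2
    ((1 / 2 : ℝ) • z.fst + z.snd, (3 / 4 : ℝ) • z.fst - (1 / 2 : ℝ) • z.snd)))

/-- The Fourier transform `(k, p) ↦ (G(-lam) ξ)^(k, p)` of the potential of the charge `ξ`. -/
def potentialHat (lam : ℝ) (ξ : L2 R3) (z : R6) : ℂ :=
  ((Real.sqrt (2 / Real.pi) : ℝ) : ℂ) *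
    (hat ξ z.snd + hat ξ (z.fst - (1 / 2 : ℝ) • z.snd) + hat ξ (-z.fst - (1 / 2 : ℝ) • z.snd)) /
      ((‖z.fst‖ ^ 2 + 3 / 4 * ‖z.snd‖ ^ 2 + lam : ℝ) : ℂ)

/-- The admissible profiles of the three-body regularization: real measurable functions `θ` on the
half-line with compact support and `1 - s/b ≤ θ(s) ≤ 1 + s/b` for some `b > 0`. -/
def IsProfile (θ : ℝ≥0 → ℝ) : Prop :=
  Measurable θ ∧ HasCompactSupport θ ∧
    ∃ b : ℝ, 0 < b ∧ ∀ s : ℝ≥0, 1 - (s : ℝ) / b ≤ θ s ∧ θ s ≤ 1 + (s : ℝ) / b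

/-- `β(y) = -1/a + γ (θ(|y|) - 1)/|y|`. -/
def boundedPotential (a γ : ℝ) (θ : ℝ≥0 → ℝ) (y : R3) : ℝ :=
  -1 / a + γ * ((θ ‖y‖₊ - 1) / ‖y‖)

/-- The diagonal part of the charge form. -/
def phiDiag (lam : ℝ) (ξ : L2 R3) : ℝ :=
  12 * Real.pi * ∫ p : R3, Real.sqrt (3 / 4 * ‖p‖ ^ 2 + lam) * ‖hat ξ p‖ ^ 2

/-- The off-diagonal part of the charge form. The kernel is real and symmetric, so the double
integral is a real number; it converges absolutely for `ξ ∈ H^(1/2)`. -/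
def phiOff (lam : ℝ) (ξ : L2 R3) : ℝ :=
  -(12 / Real.pi) * (∫ z : R3 × R3, (starRingEnd ℂ) (hat ξ z.1) * hat ξ z.2 /
    ((‖z.1‖ ^ 2 + ‖z.2‖ ^ 2 + inner ℝ z.1 z.2 + lam : ℝ) : ℂ)).re

/-- The regularizing part of the charge form. The kernel is real and symmetric, so the double
integral is a real number; it converges absolutely for `ξ ∈ H^(1/2)`. -/
def phiReg (γ : ℝ) (ξ : L2 R3) : ℝ :=
  6 * γ / Real.pi * (∫ z : R3 × R3, (starRingEnd ℂ) (hat ξ z.1) * hat ξ z.2 /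
    ((‖z.1 - z.2‖ ^ 2 : ℝ) : ℂ)).re

/-- The bounded part of the charge form. -/
def phiZero (a γ : ℝ) (θ : ℝ≥0 → ℝ) (ξ : L2 R3) : ℝ :=
  12 * Real.pi * ∫ y : R3, boundedPotential a γ θ y * ‖ξ y‖ ^ 2

/-- The charge form `Φ^lam`, with domain `H^(1/2)(ℝ³)`. -/
def chargeForm (a γ : ℝ) (θ : ℝ≥0 → ℝ) (lam : ℝ) (ξ : L2 R3) : ℝ :=
  phiDiag lam ξ + phiOff lam ξ + phiReg γ ξ + phiZero a γ θ ξ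

/-- `ψ` lies in the domain of `Q`, with decomposition `ψ = φ + G(-lam) ξ`: `ψ ∈ L²_sym(ℝ⁶)`,
`φ ∈ H¹(ℝ⁶)` and `ξ ∈ H^(1/2)(ℝ³)`. The identity is read on the Fourier side, where `G(-lam) ξ` is
given explicitly. For fixed `lam > 0` the pair `(φ, ξ)` is determined by `ψ`. -/
structure IsDecomposition (lam : ℝ) (ψ φ : L2 R6) (ξ : L2 R3) : Prop where
  symmetric : IsSymmetric ψ
  regular : MemH 1 φ
  charge : MemH (1 / 2) ξ
  decomp : ∀ᵐ z : R6, hat ψ z = hat φ z + potentialHat lam ξ z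

/-- `‖H₀^(1/2) φ‖²` for `H₀ = -Δ_x - (3/4) Δ_y`. -/
def kineticEnergy (φ : L2 R6) : ℝ :=
  ∫ z : R6, (‖z.fst‖ ^ 2 + 3 / 4 * ‖z.snd‖ ^ 2) * ‖hat φ z‖ ^ 2

/-- The value `Q[ψ]`, computed from the decomposition `ψ = φ + G(-lam) ξ`. -/
def quadraticForm (a γ : ℝ) (θ : ℝ≥0 → ℝ) (lam : ℝ) (ψ φ : L2 R6) (ξ : L2 R3) : ℝ :=
  kineticEnergy φ + lam * ‖φ‖ ^ 2 - lam * ‖ψ‖ ^ 2 + chargeForm a γ θ lam ξ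

/-- The threshold `γ_c = 4/3 - √3/π`. -/
def gammaC : ℝ := 4 / 3 - Real.sqrt 3 / Real.pi

end ThreeBosons

end

noncomputable section

namespace ThreeBosons

open MeasureTheory FourierTransform
open scoped NNReal SchwartzMap

/-! The form is tested on states ψ = G(-lam)ξ with vanishing regular part, so that Q[ψ] = Φ[ξ] -
lam‖ψ‖². The charge has Fourier transform |p|⁻² on the shell exp n ≤ |p| ≤ exp m and 0 elsewhere.
This is the scale-critical power: at lam = 0 the diagonal, off-diagonal and regularizing terms
become translation invariant in x = log |p|, hence each grows linearly in the logarithmic length m -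
n.

With m - n = L, the diagonal term is 48π² · (√3/2) · L. For the other two, integration over angles
reduces (p² + q² + κ p·q)⁻¹ to 8π² times the convolution kernel `waveKernel κ (y - x)` on [n, m]²,
with κ = 1 for the off-diagonal term and κ = -2 for |p - q|⁻². The total masses of these kernels are
π²/3 and π²/2 (`lintegral_waveKernel_one`, `lintegral_waveKernel_neg_two`). The leading coefficient
is therefore 24√3π² - 32π³ + 24π³γ = 24π³(γ - γ_c), which is negative below the threshold.

Everything else stays bounded as m → ∞ with n fixed: ‖ξ‖² ≤ 4π exp(-n) by `integral_profile_sq_le`,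
the potential β is bounded, and ‖ψ‖² is at most a constant times ‖ξ‖² (`exists_trial_state`). The
parameter lam costs only a small factor in the leading terms once lam ≤ η exp(2n), and the slack in
γ < γ_c absorbs it (`exists_coefficient_neg`). So Φ tends to -∞ while ‖ψ‖ stays bounded. -/

/-- The normalisation of the unitary Fourier transform. -/
def hatConst (V : Type) [NormedAddCommGroup V] [InnerProductSpace ℝ V] : ℝ :=
  (2 * Real.pi) ^ (-(Module.finrank ℝ V : ℝ) / 2)

lemma hatConst_pos {V : Type} [NormedAddCommGroup V] [InnerProductSpace ℝ V] :
    0 < hatConst V := by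
  unfold hatConst; positivity

/-! ### The unitary Fourier transform: Plancherel, linear symmetries, Sobolev membership. -/

section Fourier

variable {V : Type} [NormedAddCommGroup V] [InnerProductSpace ℝ V] [FiniteDimensional ℝ V]
  [MeasurableSpace V] [BorelSpace V]

lemma quasiMeasurePreserving_smul {r : ℝ} (hr : r ≠ 0) :
    Measure.QuasiMeasurePreserving (fun x : V => r • x) volume volume := by
  refine ⟨measurable_const_smul r, ?_⟩
  rw [Measure.map_addHaar_smul _ hr]
  exact Measure.smul_absolutelyContinuous

lemma memLp_comp_smul {g : V → ℂ} (hg : MemLp g 2 volume) {r : ℝ} (hr : r ≠ 0) :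
    MemLp (fun x => g (r • x)) 2 volume := by
  have h : MemLp g 2 (Measure.map (fun x : V => r • x) volume) := by
    rw [Measure.map_addHaar_smul _ hr]
    exact hg.smul_measure ENNReal.ofReal_ne_top
  exact h.comp_of_map (measurable_const_smul r).aemeasurable

lemma norm_toLp_sq {g : V → ℂ} (hg : MemLp g 2 volume) :
    ‖hg.toLp g‖ ^ 2 = ∫ x, ‖g x‖ ^ 2 := by
  have h : ((inner ℂ (hg.toLp g) (hg.toLp g) : ℂ)).re = ∫ x, ‖g x‖ ^ 2 := by
    rw [L2.inner_def]
    have : (fun x => (inner ℂ (hg.toLp g x) (hg.toLp g x) : ℂ)) =ᵐ[volume]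
        fun x => ((‖g x‖ ^ 2 : ℝ) : ℂ) := by
      filter_upwards [hg.coeFn_toLp] with x hx
      rw [hx, inner_self_eq_norm_sq_to_K]
      simp
    rw [integral_congr_ae this, integral_complex_ofReal, Complex.ofReal_re]
  rw [← h, inner_self_eq_norm_sq_to_K]
  norm_cast

lemma hat_eq (u : L2 V) (p : V) :
    hat u p = (hatConst V : ℂ) * (𝓕 u : L2 V) ((2 * Real.pi)⁻¹ • p) := rfl

/-- Every square-integrable function is the unitary Fourier transform of some `u ∈ L²`, and
Plancherel's identity holds. -/
lemma exists_hat_eq {g : V → ℂ} (hg : MemLp g 2 volume) :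
    ∃ u : L2 V, hat u =ᵐ[volume] g ∧ ‖u‖ ^ 2 = ∫ x, ‖g x‖ ^ 2 ∧
      (𝓕 u : L2 V) =ᵐ[volume] fun w => ((hatConst V)⁻¹ : ℂ) * g ((2 * Real.pi) • w) := by
  have h2 : (2 * Real.pi) ≠ 0 := by positivity
  have hc := (hatConst_pos (V := V)).ne'
  have hG : MemLp (fun w => ((hatConst V)⁻¹ : ℂ) * g ((2 * Real.pi) • w)) 2 volume :=
    (memLp_comp_smul hg h2).const_mul _
  have hF : (𝓕 (𝓕⁻ (hG.toLp _)) : L2 V) = hG.toLp _ := fourier_fourierInv_eq _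
  refine ⟨𝓕⁻ (hG.toLp _), ?_, ?_, ?_⟩
  · have := (quasiMeasurePreserving_smul (V := V) (inv_ne_zero h2)).ae hG.coeFn_toLp
    filter_upwards [this] with p hp
    rw [hat_eq, hF, hp, smul_smul, mul_inv_cancel₀ h2, one_smul, ← mul_assoc,
      mul_inv_cancel₀ (by exact_mod_cast hc), one_mul]
  · rw [← Lp.norm_fourier_eq, hF, norm_toLp_sq]
    have : (fun x => ‖((hatConst V)⁻¹ : ℂ) * g ((2 * Real.pi) • x)‖ ^ 2) =
        fun x => (hatConst V)⁻¹ ^ 2 * (fun y => ‖g y‖ ^ 2) ((2 * Real.pi) • x) := by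
      ext x
      rw [norm_mul, mul_pow]
      congr 2
      rw [norm_inv, Complex.norm_real, Real.norm_of_nonneg hatConst_pos.le]
    rw [this, integral_const_mul,
      Measure.integral_comp_smul volume (fun y => ‖g y‖ ^ 2), smul_eq_mul, ← mul_assoc]
    have key : (hatConst V)⁻¹ ^ 2 * |((2 * Real.pi) ^ Module.finrank ℝ V)⁻¹| = 1 := by
      rw [abs_of_pos (by positivity), hatConst, inv_pow, ← Real.rpow_natCast, ← Real.rpow_mul
        (by positivity), ← Real.rpow_natCast, ← mul_inv, ← Real.rpow_add (by positivity)]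
      simp
    rw [key, one_mul]
  · rw [hF]
    exact hG.coeFn_toLp

lemma hat_zero_ae : hat (0 : L2 V) =ᵐ[volume] 0 := by
  have h2 : (2 * Real.pi) ≠ 0 := by positivity
  have h0 : (𝓕 (0 : L2 V) : L2 V) = 0 := map_zero (Lp.fourierTransformₗᵢ V ℂ)
  filter_upwards [(quasiMeasurePreserving_smul (V := V) (inv_ne_zero h2)).ae
    (Lp.coeFn_zero ℂ 2 (volume : Measure V))] with p hp
  rw [hat_eq, h0, hp]
  simp

/-- A linear involution preserves Lebesgue measure. -/
lemma measurePreserving_of_involutive (S : V →L[ℝ] V) (hS : ∀ x, S (S x) = x) :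
    MeasurePreserving S volume volume := by
  refine ⟨S.continuous.measurable, ?_⟩
  have h1 : LinearMap.det (S : V →ₗ[ℝ] V) * LinearMap.det (S : V →ₗ[ℝ] V) = 1 := by
    rw [← LinearMap.det_comp]
    have : (S : V →ₗ[ℝ] V) ∘ₗ (S : V →ₗ[ℝ] V) = LinearMap.id := by
      ext x; simp [hS]
    rw [this, LinearMap.det_id]
  have hne : LinearMap.det (S : V →ₗ[ℝ] V) ≠ 0 := by
    intro h; rw [h] at h1; simp at h1
  have habs : |(LinearMap.det (S : V →ₗ[ℝ] V))⁻¹| = 1 := by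
    rcases mul_self_eq_one_iff.mp h1 with h | h <;> simp [h]
  have := Measure.map_linearMap_addHaar_eq_smul_addHaar (volume : Measure V) hne
  rw [habs] at this
  simpa using this

/-- A linear involution as a continuous linear equivalence. -/
def involutionEquiv (S : V →L[ℝ] V) (hS : ∀ x, S (S x) = x) : V ≃L[ℝ] V :=
  ContinuousLinearEquiv.equivOfInverse S S hS hS

/-- Change of variables x ↦ S x: an involution is its own inverse and has |det| = 1, and the phase
moves S to its adjoint T. -/
lemma fourier_comp_involution_schwartz (S T : V →L[ℝ] V) (hS : ∀ x, S (S x) = x)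
    (hST : ∀ x y, inner ℝ (S x) y = inner ℝ x (T y)) (f : 𝓢(V, ℂ)) (w : V) :
    𝓕 (fun x => f (S x)) w = 𝓕 (f : V → ℂ) (T w) := by
  have hmp := measurePreserving_of_involutive S hS
  have hemb : MeasurableEmbedding S :=
    (involutionEquiv S hS).toHomeomorph.measurableEmbedding
  rw [Real.fourier_eq, Real.fourier_eq]
  rw [← hmp.integral_comp hemb]
  congr 1
  ext x
  rw [← hST, hS]

/-- Both sides are continuous in u, so it suffices to check Schwartz functions, which are dense in
L². -/
lemma fourier_compMeasurePreserving (S T : V →L[ℝ] V) (hS : ∀ x, S (S x) = x)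
    (hT : ∀ x, T (T x) = x) (hST : ∀ x y, inner ℝ (S x) y = inner ℝ x (T y)) (u : L2 V) :
    (𝓕 (Lp.compMeasurePreserving S (measurePreserving_of_involutive S hS) u) : L2 V) =
      Lp.compMeasurePreserving T (measurePreserving_of_involutive T hT) (𝓕 u : L2 V) := by
  refine DenseRange.induction_on (p := fun u : L2 V =>
    (𝓕 (Lp.compMeasurePreserving S (measurePreserving_of_involutive S hS) u) : L2 V) =
      Lp.compMeasurePreserving T (measurePreserving_of_involutive T hT) (𝓕 u : L2 V))
    (SchwartzMap.denseRange_toLpCLM (p := 2) (μ := (volume : Measure V)) (E := V) (F := ℂ)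
      ENNReal.ofNat_ne_top) u ?_ ?_
  · apply isClosed_eq
    · exact (Lp.fourierTransformₗᵢ V ℂ).continuous.comp
        (Lp.isometry_compMeasurePreserving _).continuous
    · exact (Lp.isometry_compMeasurePreserving _).continuous.comp
        (Lp.fourierTransformₗᵢ V ℂ).continuous
  · intro f
    let fS : 𝓢(V, ℂ) := SchwartzMap.compCLMOfContinuousLinearEquiv ℂ (involutionEquiv S hS) f
    have h1 : Lp.compMeasurePreserving S (measurePreserving_of_involutive S hS)
        (f.toLp 2 volume) = fS.toLp 2 volume := by
      apply Lp.ext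
      refine (Lp.coeFn_compMeasurePreserving _ _).trans ?_
      refine ((measurePreserving_of_involutive S hS).quasiMeasurePreserving.ae_eq_comp
        (f.coeFn_toLp 2 volume)).trans ?_
      exact (fS.coeFn_toLp 2 volume).symm
    rw [SchwartzMap.toLpCLM_apply]
    rw [h1, SchwartzMap.toLp_fourier_eq, SchwartzMap.toLp_fourier_eq]
    apply Lp.ext
    refine ((𝓕 fS).coeFn_toLp 2 volume).trans ?_
    refine Filter.EventuallyEq.trans ?_ (Lp.coeFn_compMeasurePreserving _ _).symm
    refine Filter.EventuallyEq.trans ?_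
      ((measurePreserving_of_involutive T hT).quasiMeasurePreserving.ae_eq_comp
        ((𝓕 f).coeFn_toLp 2 volume)).symm
    refine Filter.Eventually.of_forall fun w => ?_
    exact fourier_comp_involution_schwartz S T hS hST f w

/-- If `û` is invariant under the adjoint of a linear involution `S`, then `u` is invariant
under `S`. -/
lemma ae_eq_comp_of_hat_ae_eq (S T : V →L[ℝ] V) (hS : ∀ x, S (S x) = x)
    (hT : ∀ x, T (T x) = x) (hST : ∀ x y, inner ℝ (S x) y = inner ℝ x (T y)) (u : L2 V)
    (hu : ∀ᵐ p, hat u p = hat u (T p)) : ∀ᵐ x, u x = u (S x) := by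
  have h2 : (2 * Real.pi) ≠ 0 := by positivity
  have hc := (hatConst_pos (V := V)).ne'
  have h1 : Lp.compMeasurePreserving T (measurePreserving_of_involutive T hT) (𝓕 u : L2 V) =
      (𝓕 u : L2 V) := by
    apply Lp.ext
    refine (Lp.coeFn_compMeasurePreserving _ _).trans ?_
    filter_upwards [(quasiMeasurePreserving_smul (V := V) h2).ae hu] with p hp
    rw [hat_eq, hat_eq, map_smul, smul_smul, smul_smul, inv_mul_cancel₀ h2, one_smul,
      one_smul] at hp
    exact (mul_left_cancel₀ (by exact_mod_cast hc) hp).symm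
  rw [← fourier_compMeasurePreserving S T hS hT hST] at h1
  have h3 : Lp.compMeasurePreserving S (measurePreserving_of_involutive S hS) u = u :=
    (Lp.fourierTransformₗᵢ V ℂ).injective h1
  have h4 := Lp.coeFn_compMeasurePreserving u (measurePreserving_of_involutive S hS)
  rw [h3] at h4
  exact h4

/-- Reduces Sobolev regularity to square integrability of the weighted transform; the weighted
function represents the distribution that the definition asks for. -/
lemma memH_of_memLp {s : ℝ} {u : L2 V}
    (h : MemLp (fun x => (((1 + ‖x‖ ^ 2) ^ (s / 2) : ℝ) : ℂ) * (𝓕 u : L2 V) x) 2 volume) :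
    MemH s u := by
  rw [MemH, TemperedDistribution.memSobolev_iff_exists_smulLeftCLM_fourier]
  refine ⟨h.toLp _, ?_⟩
  rw [Lp.fourier_toTemperedDistribution_eq]
  ext f
  rw [TemperedDistribution.smulLeftCLM_apply_apply, Lp.toTemperedDistribution_apply,
    Lp.toTemperedDistribution_apply]
  apply integral_congr_ae
  filter_upwards [h.coeFn_toLp] with x hx
  rw [hx, SchwartzMap.smulLeftCLM_apply_apply (by fun_prop)]
  simp only [smul_eq_mul]
  ring

lemma memH_zero (s : ℝ) : MemH s (0 : L2 V) := by
  have : ((0 : L2 V) : 𝓢'(V, ℂ)) = 0 := map_zero (Lp.toTemperedDistributionCLM ℂ volume 2)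
  rw [MemH, this]
  exact TemperedDistribution.memSobolev_fun_zero V ℂ s 2

end Fourier

/-! ### Integration over ℝ³ in radial and logarithmic variables. -/

section Radial

open Set ENNReal

lemma exists_rotation (p : R3) :
    ∃ U : R3 ≃ₗᵢ[ℝ] R3, ∀ q : R3, inner ℝ p (U q) = ‖p‖ * q 0 := by
  let e : R3 := EuclideanSpace.single 0 1
  have he : ‖e‖ = 1 := by simp [e]
  let v : R3 := ‖p‖ • e
  have hv : ‖v‖ = ‖p‖ := by simp [v, norm_smul, he]
  -- Vectors of equal length are exchanged by the reflection in the hyperplane orthogonal to their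
  -- difference.
  let U : R3 ≃ₗᵢ[ℝ] R3 := (ℝ ∙ (v - p))ᗮ.reflection
  have hU : U v = p := Submodule.reflection_sub hv
  refine ⟨U, fun q => ?_⟩
  rw [← hU, LinearIsometryEquiv.inner_map_map, hU]
  simp [v, e, inner_smul_left, EuclideanSpace.inner_single_left]

lemma lintegral_R3 (H : ℝ → ℝ × ℝ → ℝ≥0∞) (hH : Measurable (Function.uncurry H)) :
    ∫⁻ q : R3, H (q 0) (q 1, q 2) = ∫⁻ t : ℝ, ∫⁻ w : ℝ × ℝ, H t w := by
  have h1 := PiLp.volume_preserving_ofLp (Fin 3)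
  have h2 := volume_preserving_piFinSuccAbove (fun _ : Fin 3 => ℝ) 0
  have h3 := (MeasurePreserving.id (volume : Measure ℝ)).prod (volume_preserving_finTwoArrow ℝ)
  have h := h3.comp (h2.comp h1)
  have := h.lintegral_comp hH
  rw [lintegral_prod _ hH.aemeasurable] at this
  exact this

lemma lintegral_prod_sq (G : ℝ → ℝ≥0∞) (hG : Measurable G) :
    ∫⁻ w : ℝ × ℝ, G (w.1 ^ 2 + w.2 ^ 2) =
      ENNReal.ofReal (2 * Real.pi) * ∫⁻ ρ in Ioi (0 : ℝ), ENNReal.ofReal ρ * G (ρ ^ 2) := by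
  rw [← lintegral_comp_polarCoord_symm (fun w : ℝ × ℝ => G (w.1 ^ 2 + w.2 ^ 2))]
  have h : ∀ z : ℝ × ℝ, (polarCoord.symm z).1 ^ 2 + (polarCoord.symm z).2 ^ 2 = z.1 ^ 2 := by
    intro z
    rw [polarCoord_symm_apply]
    simp only
    nlinarith [Real.sin_sq_add_cos_sq z.2]
  simp_rw [h, smul_eq_mul]
  rw [polarCoord_target, Measure.volume_eq_prod, ← Measure.prod_restrict,
    lintegral_prod _ (by fun_prop)]
  simp only [lintegral_const, Measure.restrict_apply MeasurableSet.univ, univ_inter,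
    Real.volume_Ioo]
  rw [lintegral_mul_const _ (by fun_prop), mul_comm]
  congr 2
  ring

lemma image_sqrt_sq_add (t : ℝ) :
    (fun ρ : ℝ => Real.sqrt (t ^ 2 + ρ ^ 2)) '' Ioi 0 = Ioi |t| := by
  ext r
  simp only [mem_image, mem_Ioi]
  constructor
  · rintro ⟨ρ, hρ, rfl⟩
    apply Real.lt_sqrt_of_sq_lt
    rw [sq_abs]
    nlinarith
  · intro hr
    have h0 : 0 < r := (abs_nonneg t).trans_lt hr
    have h1 : 0 < r ^ 2 - t ^ 2 := by
      have := sq_lt_sq' (by linarith [abs_nonneg t]) hr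
      rw [sq_abs] at this
      linarith
    refine ⟨Real.sqrt (r ^ 2 - t ^ 2), Real.sqrt_pos.mpr h1, ?_⟩
    rw [Real.sq_sqrt h1.le, add_sub_cancel, Real.sqrt_sq h0.le]

/-- Substitution r² = t² + ρ², for which r dr = ρ dρ: it turns the cylindrical radius ρ at height t
into the spherical radius r. -/
lemma lintegral_sqrt_sq_add (t : ℝ) (g : ℝ → ℝ≥0∞) :
    ∫⁻ ρ in Ioi (0 : ℝ), ENNReal.ofReal ρ * g (Real.sqrt (t ^ 2 + ρ ^ 2)) =
      ∫⁻ r in Ioi |t|, ENNReal.ofReal r * g r := by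
  have hpos : ∀ ρ ∈ Ioi (0 : ℝ), 0 < t ^ 2 + ρ ^ 2 := fun ρ hρ => by
    have : 0 < ρ := hρ
    positivity
  rw [← image_sqrt_sq_add t, lintegral_image_eq_lintegral_deriv_mul_of_monotoneOn
    (f' := fun ρ => ρ / Real.sqrt (t ^ 2 + ρ ^ 2)) measurableSet_Ioi]
  · refine setLIntegral_congr_fun measurableSet_Ioi fun ρ hρ => ?_
    have h := Real.sqrt_pos.mpr (hpos ρ hρ)
    have hρ' : 0 < ρ := hρ
    rw [← mul_assoc, ← ENNReal.ofReal_mul (by positivity), div_mul_cancel₀ _ h.ne']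
  · intro ρ hρ
    have h1 : HasDerivAt (fun x : ℝ => t ^ 2 + x ^ 2) (2 * ρ) ρ := by
      simpa using ((hasDerivAt_id ρ).pow 2).const_add (t ^ 2)
    have h2 := h1.sqrt (hpos ρ hρ).ne'
    rw [mul_div_mul_left _ _ two_ne_zero] at h2
    exact h2.hasDerivWithinAt
  · intro x hx y hy hxy
    have : 0 < x := hx
    apply Real.sqrt_le_sqrt
    nlinarith

/-- Integration over `ℝ³` of a function of `|q|` and `p · q`. -/
lemma lintegral_norm_inner (F : ℝ → ℝ → ℝ≥0∞) (hF : Measurable (Function.uncurry F)) (p : R3) :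
    ∫⁻ q : R3, F ‖q‖ (inner ℝ p q) = ENNReal.ofReal (2 * Real.pi) *
      ∫⁻ r in Ioi (0 : ℝ), ENNReal.ofReal r * ∫⁻ t in Ioo (-r) r, F r (‖p‖ * t) := by
  obtain ⟨U, hU⟩ := exists_rotation p
  have hF' : ∀ {α : Type} [MeasurableSpace α] {f g : α → ℝ}, Measurable f → Measurable g →
      Measurable fun x => F (f x) (g x) := fun hf hg => hF.comp (hf.prodMk hg)
  rw [← U.measurePreserving.lintegral_comp_emb U.toHomeomorph.measurableEmbedding]
  simp_rw [hU, U.norm_map]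
  generalize ‖p‖ = a
  have hn : ∀ q : R3, ‖q‖ = Real.sqrt ((q 0) ^ 2 + ((q 1) ^ 2 + (q 2) ^ 2)) := fun q => by
    rw [EuclideanSpace.norm_eq, Fin.sum_univ_three]
    simp [add_assoc]
  simp_rw [hn]
  rw [lintegral_R3 (fun t w => F (Real.sqrt (t ^ 2 + (w.1 ^ 2 + w.2 ^ 2))) (a * t))
    (hF' (by fun_prop) (by fun_prop))]
  have h1 : ∀ t : ℝ, ∫⁻ w : ℝ × ℝ, F (Real.sqrt (t ^ 2 + (w.1 ^ 2 + w.2 ^ 2))) (a * t) =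
      ENNReal.ofReal (2 * Real.pi) * ∫⁻ r in Ioi |t|, ENNReal.ofReal r * F r (a * t) := by
    intro t
    rw [lintegral_prod_sq (fun s => F (Real.sqrt (t ^ 2 + s)) (a * t))
      (hF' (by fun_prop) (by fun_prop)), lintegral_sqrt_sq_add t (fun r => F r (a * t))]
  simp_rw [h1]
  rw [lintegral_const_mul' _ _ ENNReal.ofReal_ne_top]
  congr 1
  have hS : MeasurableSet {z : ℝ × ℝ | |z.1| < z.2} :=
    measurableSet_lt (by fun_prop) (by fun_prop)
  have h2 : ∀ t : ℝ, ∫⁻ r in Ioi |t|, ENNReal.ofReal r * F r (a * t) =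
      ∫⁻ r, {z : ℝ × ℝ | |z.1| < z.2}.indicator
        (fun z => ENNReal.ofReal z.2 * F z.2 (a * z.1)) (t, r) := by
    intro t
    rw [← lintegral_indicator measurableSet_Ioi]
    rfl
  simp_rw [h2]
  have hm : Measurable fun z : ℝ × ℝ => ENNReal.ofReal z.2 * F z.2 (a * z.1) :=
    Measurable.mul (by fun_prop) (hF' (by fun_prop) (by fun_prop))
  rw [lintegral_lintegral_swap (f := fun t r => {z : ℝ × ℝ | |z.1| < z.2}.indicator
        (fun z => ENNReal.ofReal z.2 * F z.2 (a * z.1)) (t, r)) (hm.indicator hS).aemeasurable]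
  rw [← lintegral_indicator measurableSet_Ioi]
  congr 1
  ext r
  by_cases hr : 0 < r
  · rw [indicator_of_mem (mem_Ioi.mpr hr), ← lintegral_const_mul' _ _ ENNReal.ofReal_ne_top,
      ← lintegral_indicator measurableSet_Ioo]
    congr 1
    ext t
    simp only [indicator, mem_ofPred_eq, mem_Ioo, abs_lt]
  · rw [indicator_of_notMem (by simpa using hr)]
    rw [← lintegral_zero (μ := (volume : Measure ℝ))]
    congr 1
    ext t
    rw [indicator_of_notMem]
    simp only [mem_ofPred_eq, not_lt]
    linarith [abs_nonneg t]

lemma lintegral_Ioi_exp (h : ℝ → ℝ≥0∞) :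
    ∫⁻ r in Ioi (0 : ℝ), h r = ∫⁻ x : ℝ, ENNReal.ofReal (Real.exp x) * h (Real.exp x) := by
  rw [← Real.range_exp, ← image_univ, lintegral_image_eq_lintegral_deriv_mul_of_monotoneOn
    MeasurableSet.univ (fun x _ => (Real.hasDerivAt_exp x).hasDerivWithinAt)
    (Real.exp_monotone.monotoneOn _), setLIntegral_univ]

/-- Integration of radial functions over `ℝ³`, in the logarithmic variable. -/
lemma lintegral_norm (H : ℝ → ℝ≥0∞) (hH : Measurable H) :
    ∫⁻ q : R3, H ‖q‖ = ENNReal.ofReal (4 * Real.pi) *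
      ∫⁻ x : ℝ, ENNReal.ofReal (Real.exp x ^ 3) * H (Real.exp x) := by
  have h : ∀ x : ℝ, ENNReal.ofReal (Real.exp x) * (ENNReal.ofReal (Real.exp x) *
      ∫⁻ _ in Ioo (-Real.exp x) (Real.exp x), H (Real.exp x)) =
      ENNReal.ofReal 2 * (ENNReal.ofReal (Real.exp x ^ 3) * H (Real.exp x)) := by
    intro x
    have := Real.exp_pos x
    rw [setLIntegral_const, Real.volume_Ioo, mul_comm (H _), ← mul_assoc, ← mul_assoc,
      ← ENNReal.ofReal_mul (by positivity), ← ENNReal.ofReal_mul (by positivity), ← mul_assoc,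
      ← ENNReal.ofReal_mul (by positivity)]
    congr 2
    ring
  rw [lintegral_norm_inner (fun r _ => H r) (by fun_prop) 0, lintegral_Ioi_exp]
  simp_rw [h]
  rw [lintegral_const_mul _ (by fun_prop), ← mul_assoc, ← ENNReal.ofReal_mul (by positivity)]
  congr 2
  ring

end Radial

/-! ### The logarithmic convolution kernels and their total masses. -/

section Kernel

open Set ENNReal

/-- The `s`-wave of the kernel `(p² + q² + κ p · q)⁻¹` in the logarithmic radial variables. -/
def waveKernel (κ t : ℝ) : ℝ :=
  1 / κ * Real.log ((2 * Real.cosh t + κ) / (2 * Real.cosh t - κ))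

lemma measurable_waveKernel (κ : ℝ) : Measurable (waveKernel κ) := by
  unfold waveKernel
  have : Measurable Real.cosh := Real.continuous_cosh.measurable
  fun_prop

lemma waveKernel_neg (κ t : ℝ) : waveKernel κ (-t) = waveKernel κ t := by
  simp [waveKernel]

lemma two_mul_cosh (t : ℝ) :
    2 * Real.cosh t = (Real.exp t ^ 2 + 1) / Real.exp t := by
  have := (Real.exp_pos t).ne'
  rw [Real.cosh_eq, Real.exp_neg]
  field_simp

/-- For κ = -2 the quotient is a perfect square, which cancels the prefactor -1/2. For t > 0 the
last term is still meaningful because `Real.log` is the logarithm of the absolute value; t = 0 is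
the singularity. -/
lemma waveKernel_neg_two_eq {t : ℝ} (ht : t ≠ 0) :
    waveKernel (-2) t = Real.log (1 + Real.exp t) - Real.log (1 - Real.exp t) := by
  have hE := Real.exp_pos t
  have h1 : 1 - Real.exp t ≠ 0 := by
    rw [sub_ne_zero]
    intro h
    exact ht (by simpa using h.symm)
  have h2 : (2 * Real.cosh t + -2) / (2 * Real.cosh t - -2) =
      ((1 - Real.exp t) / (1 + Real.exp t)) ^ 2 := by
    rw [two_mul_cosh, div_add' _ _ _ hE.ne', div_sub' hE.ne', div_div_div_cancel_right₀ hE.ne',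
      div_pow]
    congr 1 <;> ring
  rw [waveKernel, h2, Real.log_pow, Real.log_div h1 (by positivity)]
  push_cast
  ring

/-- With E = exp t, the factorizations 1 ± E³ = (1 ± E)(1 ∓ E + E²) express the κ = 1 kernel through
the κ = -2 kernel and its dilation, so only one mass has to be computed. -/
lemma waveKernel_one_eq {t : ℝ} (ht : t ≠ 0) :
    waveKernel 1 t = waveKernel (-2) t - waveKernel (-2) (3 * t) := by
  have hE := Real.exp_pos t
  have h1 : 1 - Real.exp t ≠ 0 := by
    rw [sub_ne_zero]
    intro h
    exact ht (by simpa using h.symm)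
  rw [waveKernel_neg_two_eq ht, waveKernel_neg_two_eq (by simpa using ht)]
  have h3 : Real.exp (3 * t) = Real.exp t ^ 3 := by
    rw [← Real.exp_nat_mul]; norm_num
  have hp : 0 < 1 + Real.exp t + Real.exp t ^ 2 := by positivity
  have hm : 0 < 1 - Real.exp t + Real.exp t ^ 2 := by nlinarith [sq_nonneg (Real.exp t - 1)]
  have h4 : 1 + Real.exp t ^ 3 = (1 + Real.exp t) * (1 - Real.exp t + Real.exp t ^ 2) := by ring
  have h5 : 1 - Real.exp t ^ 3 = (1 - Real.exp t) * (1 + Real.exp t + Real.exp t ^ 2) := by ring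
  have h6 : (2 * Real.cosh t + 1) / (2 * Real.cosh t - 1) =
      (1 + Real.exp t + Real.exp t ^ 2) / (1 - Real.exp t + Real.exp t ^ 2) := by
    rw [two_mul_cosh, div_add' _ _ _ hE.ne', div_sub' hE.ne', div_div_div_cancel_right₀ hE.ne']
    congr 1 <;> ring
  rw [h3, h4, h5, Real.log_mul (by positivity) hm.ne', Real.log_mul h1 hp.ne', waveKernel, h6,
    Real.log_div hp.ne' hm.ne']
  ring

lemma waveKernel_neg_two_nonneg (t : ℝ) : 0 ≤ waveKernel (-2) t := by
  have hc := Real.one_le_cosh t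
  have : Real.log ((2 * Real.cosh t + -2) / (2 * Real.cosh t - -2)) ≤ 0 := by
    apply Real.log_nonpos
    · apply div_nonneg <;> linarith
    · rw [div_le_one (by linarith)]; linarith
  rw [waveKernel]
  linarith

lemma waveKernel_one_nonneg (t : ℝ) : 0 ≤ waveKernel 1 t := by
  have hc := Real.one_le_cosh t
  rw [waveKernel, div_one, one_mul]
  apply Real.log_nonneg
  rw [one_le_div (by linarith)]
  linarith

/-- The odd terms of ζ(2) sum to π²/6 - π²/24 = π²/8. -/
lemma tsum_two_div_odd_sq : ∑' k : ℕ, (2 / (2 * (k : ℝ) + 1) ^ 2) = Real.pi ^ 2 / 4 ∧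
    Summable fun k : ℕ => (2 / (2 * (k : ℝ) + 1) ^ 2) := by
  have hz := hasSum_zeta_two
  have he : HasSum (fun k : ℕ => (1 : ℝ) / ((2 * k : ℕ) : ℝ) ^ 2) (Real.pi ^ 2 / 24) := by
    have e : (fun k : ℕ => (1 : ℝ) / ((2 * k : ℕ) : ℝ) ^ 2) =
        fun k : ℕ => 1 / 4 * (1 / (k : ℝ) ^ 2) := by
      ext k
      push_cast
      rw [mul_pow, ← one_div_mul_one_div]
      norm_num
    rw [e, show Real.pi ^ 2 / 24 = 1 / 4 * (Real.pi ^ 2 / 6) by ring]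
    exact hz.mul_left _
  have ho : Summable (fun k : ℕ => (1 : ℝ) / ((2 * k + 1 : ℕ) : ℝ) ^ 2) :=
    hz.summable.comp_injective (i := fun k : ℕ => 2 * k + 1) (fun a b h => by
      have : 2 * a + 1 = 2 * b + 1 := h
      omega)
  have h := (HasSum.even_add_odd (f := fun n : ℕ => (1 : ℝ) / (n : ℝ) ^ 2) he ho.hasSum).unique hz
  have h' : HasSum (fun k : ℕ => (1 : ℝ) / ((2 * k + 1 : ℕ) : ℝ) ^ 2) (Real.pi ^ 2 / 8) := by
    rw [show Real.pi ^ 2 / 8 = ∑' k : ℕ, (1 : ℝ) / ((2 * k + 1 : ℕ) : ℝ) ^ 2 by linarith]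
    exact ho.hasSum
  have h2 : HasSum (fun k : ℕ => (2 / (2 * (k : ℝ) + 1) ^ 2)) (Real.pi ^ 2 / 4) := by
    have e : (fun k : ℕ => (2 / (2 * (k : ℝ) + 1) ^ 2)) =
        fun k : ℕ => 2 * (1 / ((2 * k + 1 : ℕ) : ℝ) ^ 2) := by
      ext k
      push_cast
      ring
    rw [e, show Real.pi ^ 2 / 4 = 2 * (Real.pi ^ 2 / 8) by ring]
    exact h'.mul_left _
  exact ⟨h2.tsum_eq, h2.summable⟩

lemma lintegral_exp_mul_Iio (c : ℝ) (hc : 0 < c) (d : ℝ) (hd : 0 ≤ d) :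
    ∫⁻ t in Iio (0 : ℝ), ENNReal.ofReal (d * Real.exp (c * t)) = ENNReal.ofReal (d / c) := by
  rw [setLIntegral_congr Iio_ae_eq_Iic, ← ofReal_integral_eq_lintegral_ofReal
    ((integrableOn_exp_mul_Iic hc 0).const_mul d)
    (Filter.Eventually.of_forall fun t => by positivity), integral_const_mul,
    integral_exp_mul_Iic hc]
  simp [div_eq_mul_inv]

/-- For t < 0 the kernel is log((1 + E)/(1 - E)) = 2 ∑ E^(2k+1)/(2k+1) with E = exp t; its terms are
nonnegative and integrate one by one to 2/(2k+1)². -/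
lemma lintegral_waveKernel_neg_two_Iio :
    ∫⁻ t in Iio (0 : ℝ), ENNReal.ofReal (waveKernel (-2) t) = ENNReal.ofReal (Real.pi ^ 2 / 4) := by
  have h1 : ∀ t ∈ Iio (0 : ℝ), ENNReal.ofReal (waveKernel (-2) t) =
      ∑' k : ℕ, ENNReal.ofReal (2 / (2 * k + 1) * Real.exp ((2 * k + 1) * t)) := by
    intro t ht
    have ht' : t < 0 := ht
    have hs := Real.hasSum_log_sub_log_of_abs_lt_one (x := Real.exp t)
      (by rw [abs_of_pos (Real.exp_pos t)]; exact Real.exp_lt_one_iff.mpr ht')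
    have hs' : HasSum (fun k : ℕ => 2 / (2 * (k : ℝ) + 1) * Real.exp ((2 * k + 1) * t))
        (waveKernel (-2) t) := by
      rw [waveKernel_neg_two_eq ht'.ne]
      convert hs using 1
      ext k
      rw [← Real.exp_nat_mul]
      push_cast
      ring
    rw [← hs'.tsum_eq, ENNReal.ofReal_tsum_of_nonneg (fun k => by positivity) hs'.summable]
  rw [setLIntegral_congr_fun measurableSet_Iio h1, lintegral_tsum (fun k => by fun_prop)]
  have h2 : ∀ k : ℕ, ∫⁻ t in Iio (0 : ℝ),
      ENNReal.ofReal (2 / (2 * k + 1) * Real.exp ((2 * k + 1) * t)) =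
      ENNReal.ofReal (2 / (2 * (k : ℝ) + 1) ^ 2) := by
    intro k
    rw [lintegral_exp_mul_Iio _ (by positivity) _ (by positivity), div_div, sq]
  simp_rw [h2]
  rw [← ENNReal.ofReal_tsum_of_nonneg (fun k => by positivity) tsum_two_div_odd_sq.2,
    tsum_two_div_odd_sq.1]

lemma lintegral_waveKernel_neg_two :
    ∫⁻ t : ℝ, ENNReal.ofReal (waveKernel (-2) t) = ENNReal.ofReal (Real.pi ^ 2 / 2) := by
  have hIoi : ∫⁻ t in Ioi (0 : ℝ), ENNReal.ofReal (waveKernel (-2) t) =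
      ENNReal.ofReal (Real.pi ^ 2 / 4) := by
    rw [← lintegral_waveKernel_neg_two_Iio, ← (Measure.measurePreserving_neg
      (volume : Measure ℝ)).setLIntegral_comp_preimage measurableSet_Ioi
      (measurable_waveKernel _).ennreal_ofReal]
    simp [waveKernel_neg]
  rw [← lintegral_add_compl _ (measurableSet_Iio (a := (0 : ℝ))), compl_Iio,
    ← setLIntegral_congr Ioi_ae_eq_Ici, hIoi, lintegral_waveKernel_neg_two_Iio,
    ← ENNReal.ofReal_add (by positivity) (by positivity)]
  congr 1
  ring

/-- The dilation by 3 divides the mass by 3, so the mass is π²/2 - π²/6. The identity is used in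
additive form, since extended nonnegative integrals do not subtract freely. -/
lemma lintegral_waveKernel_one :
    ∫⁻ t : ℝ, ENNReal.ofReal (waveKernel 1 t) = ENNReal.ofReal (Real.pi ^ 2 / 3) := by
  have h3 : ∫⁻ t : ℝ, ENNReal.ofReal (waveKernel (-2) (3 * t)) =
      ENNReal.ofReal (Real.pi ^ 2 / 6) := by
    have hm : Measurable fun t => ENNReal.ofReal (waveKernel (-2) t) :=
      (measurable_waveKernel _).ennreal_ofReal
    have := lintegral_map (μ := (volume : Measure ℝ)) hm (measurable_const_mul (3 : ℝ))
    rw [← this, Real.map_volume_mul_left (by norm_num), lintegral_smul_measure,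
      lintegral_waveKernel_neg_two, smul_eq_mul, ← ENNReal.ofReal_mul (by positivity)]
    congr 1
    rw [abs_of_pos (by norm_num)]
    ring
  have hsum : (∫⁻ t : ℝ, ENNReal.ofReal (waveKernel 1 t)) + ENNReal.ofReal (Real.pi ^ 2 / 6) =
      ENNReal.ofReal (Real.pi ^ 2 / 2) := by
    rw [← h3, ← lintegral_waveKernel_neg_two, ← lintegral_add_left
      (measurable_waveKernel _).ennreal_ofReal]
    apply lintegral_congr_ae
    have h0 : ∀ᵐ t : ℝ, t ≠ 0 := by simp [ae_iff]
    filter_upwards [h0] with t ht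
    rw [← ENNReal.ofReal_add (waveKernel_one_nonneg t) (waveKernel_neg_two_nonneg _),
      waveKernel_one_eq ht, sub_add_cancel]
  have h := ENNReal.eq_sub_of_add_eq ENNReal.ofReal_ne_top hsum
  rw [h, ← ENNReal.ofReal_sub _ (by positivity)]
  congr 1
  ring

lemma lintegral_waveKernel_box_le {n m : ℝ} (hnm : n ≤ m) :
    ∫⁻ x in Icc n m, ∫⁻ y in Icc n m, ENNReal.ofReal (waveKernel (-2) (y - x)) ≤
      ENNReal.ofReal ((m - n) * (Real.pi ^ 2 / 2)) := by
  calc ∫⁻ x in Icc n m, ∫⁻ y in Icc n m, ENNReal.ofReal (waveKernel (-2) (y - x))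
      ≤ ∫⁻ _ in Icc n m, ENNReal.ofReal (Real.pi ^ 2 / 2) := by
        apply lintegral_mono
        intro x
        refine (setLIntegral_le_lintegral _ _).trans ?_
        rw [lintegral_sub_right_eq_self (fun y => ENNReal.ofReal (waveKernel (-2) y)) x,
          lintegral_waveKernel_neg_two]
    _ = _ := by
        rw [setLIntegral_const, Real.volume_Icc, mul_comm, ← ENNReal.ofReal_mul (by linarith)]

/-- A window [-M, M] already carries mass more than c. Every x at distance at least M from both ends
sees this whole window inside the box; only the boundary layers, of total length 2M, are lost. -/
lemma exists_le_lintegral_waveKernel_box {c : ℝ} (hc : c < Real.pi ^ 2 / 3) :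
    ∃ M : ℝ, 0 ≤ M ∧ ∀ n m : ℝ, n + 2 * M ≤ m → ENNReal.ofReal ((m - n - 2 * M) * c) ≤
      ∫⁻ x in Icc n m, ∫⁻ y in Icc n m, ENNReal.ofReal (waveKernel 1 (y - x)) := by
  have hcov : AECover (volume : Measure ℝ) Filter.atTop fun k : ℝ => Icc (-k) k :=
    aecover_Icc Filter.tendsto_neg_atTop_atBot Filter.tendsto_id
  have hlim := hcov.lintegral_tendsto_of_countably_generated
    (f := fun t => ENNReal.ofReal (waveKernel 1 t))
    (measurable_waveKernel 1).ennreal_ofReal.aemeasurable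
  rw [lintegral_waveKernel_one] at hlim
  have hc' : ENNReal.ofReal c < ENNReal.ofReal (Real.pi ^ 2 / 3) :=
    (ENNReal.ofReal_lt_ofReal_iff (by positivity)).mpr hc
  obtain ⟨M, hM, hM0⟩ := ((hlim.eventually (lt_mem_nhds hc')).and
    (Filter.eventually_ge_atTop 0)).exists
  refine ⟨M, hM0, fun n m hnm => ?_⟩
  calc ENNReal.ofReal ((m - n - 2 * M) * c)
      = ∫⁻ _ in Icc (n + M) (m - M), ENNReal.ofReal c := by
        rw [setLIntegral_const, Real.volume_Icc, mul_comm,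
          ENNReal.ofReal_mul' (by linarith)]
        congr 2
        ring
    _ ≤ ∫⁻ x in Icc (n + M) (m - M), ∫⁻ y in Icc n m, ENNReal.ofReal (waveKernel 1 (y - x)) := by
        apply setLIntegral_mono' measurableSet_Icc
        intro x hx
        refine hM.le.trans ?_
        rw [← (measurePreserving_sub_right volume x).setLIntegral_comp_preimage measurableSet_Icc
          (measurable_waveKernel 1).ennreal_ofReal]
        apply lintegral_mono_set
        intro y hy
        simp only [mem_preimage, mem_Icc] at hy hx ⊢
        constructor <;> linarith
    _ ≤ _ := lintegral_mono_set (Icc_subset_Icc (by linarith) (by linarith))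

end Kernel

/-! ### Reduction of the double integrals to the logarithmic kernels. -/

section Pair

open Set ENNReal

/-- The radial profile `r⁻²`, cut off to `[exp n, exp m]`. -/
def profile (n m : ℝ) : ℝ → ℝ := (Icc (Real.exp n) (Real.exp m)).indicator fun r => (r ^ 2)⁻¹

lemma measurable_profile (n m : ℝ) : Measurable (profile n m) :=
  Measurable.indicator (by fun_prop) measurableSet_Icc

lemma profile_nonneg (n m r : ℝ) : 0 ≤ profile n m r :=
  indicator_nonneg (fun _ _ => by positivity) r

lemma profile_exp (n m x : ℝ) :
    profile n m (Real.exp x) = (Icc n m).indicator (fun x => (Real.exp x ^ 2)⁻¹) x := by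
  simp [profile, indicator, mem_Icc]

/-- The integrand has a logarithm as antiderivative, and dividing its endpoint values by exp(x + y)
produces 2 cosh(y - x) ± κ. For |κ| = 2 the denominator would vanish at an endpoint if x = y. -/
lemma lintegral_angular {κ x y C : ℝ} (hκ0 : κ ≠ 0) (hκ : |κ| ≤ 2) (hxy : y ≠ x) (hC : 0 ≤ C) :
    ∫⁻ t in Ioo (-Real.exp y) (Real.exp y),
      ENNReal.ofReal (C / (Real.exp x ^ 2 + Real.exp y ^ 2 + κ * (Real.exp x * t))) =
      ENNReal.ofReal (C / Real.exp x * waveKernel κ (y - x)) := by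
  have ha := Real.exp_pos x
  have hr := Real.exp_pos y
  have hne : Real.exp x ≠ Real.exp y := fun h => hxy (Real.exp_injective h).symm
  have hpos : ∀ t ∈ Icc (-Real.exp y) (Real.exp y),
      0 < Real.exp x ^ 2 + Real.exp y ^ 2 + κ * (Real.exp x * t) := by
    intro t ht
    have h1 : |κ * (Real.exp x * t)| ≤ 2 * (Real.exp x * Real.exp y) := by
      rw [abs_mul, abs_mul, abs_of_pos ha]
      exact mul_le_mul hκ (mul_le_mul_of_nonneg_left (abs_le.mpr ht) ha.le)
        (by positivity) (by norm_num)
    have h2 := neg_abs_le (κ * (Real.exp x * t))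
    have h3 : 0 < (Real.exp x - Real.exp y) ^ 2 := by
      have := sub_ne_zero.mpr hne
      positivity
    nlinarith
  generalize hA : Real.exp x ^ 2 + Real.exp y ^ 2 = A at *
  have hle : -Real.exp y ≤ Real.exp y := by linarith
  have hcont : ContinuousOn (fun t => C / (A + κ * (Real.exp x * t)))
      (Icc (-Real.exp y) (Real.exp y)) :=
    ContinuousOn.div (by fun_prop) (by fun_prop) fun t ht => (hpos t ht).ne'
  have hint : IntervalIntegrable (fun t => C / (A + κ * (Real.exp x * t))) volume
      (-Real.exp y) (Real.exp y) := by
    apply ContinuousOn.intervalIntegrable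
    rwa [uIcc_of_le hle]
  have hder : ∀ t ∈ uIcc (-Real.exp y) (Real.exp y),
      HasDerivAt (fun t => C / (κ * Real.exp x) * Real.log (A + κ * (Real.exp x * t)))
        (C / (A + κ * (Real.exp x * t))) t := by
    intro t ht
    rw [uIcc_of_le hle] at ht
    have h1 : HasDerivAt (fun t => A + κ * (Real.exp x * t)) (κ * (Real.exp x * 1)) t :=
      (((hasDerivAt_id t).const_mul _).const_mul _).const_add _
    have h2 := (h1.log (hpos t ht).ne').const_mul (C / (κ * Real.exp x))
    have h3 := (hpos t ht).ne'
    have h4 : C / (κ * Real.exp x) * (κ * (Real.exp x * 1) / (A + κ * (Real.exp x * t))) =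
        C / (A + κ * (Real.exp x * t)) := by
      rw [mul_one, div_mul_div_comm, mul_comm C, mul_div_mul_left _ _ (by positivity)]
    rwa [h4] at h2
  rw [← ofReal_integral_eq_lintegral_ofReal, ← integral_Ioc_eq_integral_Ioo,
    ← intervalIntegral.integral_of_le hle, intervalIntegral.integral_eq_sub_of_hasDerivAt hder hint]
  · congr 1
    have hp := hpos (Real.exp y) (right_mem_Icc.mpr hle)
    have hm := hpos (-Real.exp y) (left_mem_Icc.mpr hle)
    rw [← mul_sub, ← Real.log_div hp.ne' hm.ne', waveKernel,
      ← mul_assoc (C / Real.exp x)]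
    congr 1
    · field_simp
    · congr 1
      have hcosh : 2 * Real.cosh (y - x) = A / (Real.exp x * Real.exp y) := by
        rw [two_mul_cosh, Real.exp_sub, ← hA]
        field_simp
        ring
      have hxy0 : Real.exp x * Real.exp y ≠ 0 := by positivity
      rw [hcosh, div_add' _ _ _ hxy0, div_sub' hxy0, div_div_div_cancel_right₀ hxy0]
      congr 1
      ring
  · rw [intervalIntegrable_iff_integrableOn_Ioc_of_le hle] at hint
    exact hint.mono_set Ioo_subset_Ioc_self
  · refine (ae_restrict_iff' measurableSet_Ioo).mpr (Filter.Eventually.of_forall fun t ht => ?_)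
    exact div_nonneg hC (hpos t (Ioo_subset_Icc_self ht)).le

lemma lintegral_profile_inner {κ n m : ℝ} (hκ0 : κ ≠ 0) (hκ : |κ| ≤ 2) {p : R3} (hp : p ≠ 0) :
    ∫⁻ q : R3, ENNReal.ofReal (profile n m ‖p‖ * profile n m ‖q‖ /
        (‖p‖ ^ 2 + ‖q‖ ^ 2 + κ * inner ℝ p q)) =
      ENNReal.ofReal (2 * Real.pi * (profile n m ‖p‖ / ‖p‖)) *
        ∫⁻ y in Icc n m, ENNReal.ofReal (waveKernel κ (y - Real.log ‖p‖)) := by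
  have hp' : 0 < ‖p‖ := norm_pos_iff.mpr hp
  have hmp := measurable_profile n m
  rw [lintegral_norm_inner (fun r s => ENNReal.ofReal (profile n m ‖p‖ * profile n m r /
        (‖p‖ ^ 2 + r ^ 2 + κ * s))) (by unfold Function.uncurry; fun_prop) p, lintegral_Ioi_exp]
  obtain ⟨x, hx⟩ : ∃ x, ‖p‖ = Real.exp x := ⟨Real.log ‖p‖, (Real.exp_log hp').symm⟩
  rw [hx, Real.log_exp]
  have hae : ∀ᵐ y : ℝ, y ≠ x := by simp [ae_iff]
  have h1 : ∀ᵐ y : ℝ, ENNReal.ofReal (Real.exp y) * (ENNReal.ofReal (Real.exp y) *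
      ∫⁻ t in Ioo (-Real.exp y) (Real.exp y), ENNReal.ofReal
        (profile n m (Real.exp x) * profile n m (Real.exp y) /
          (Real.exp x ^ 2 + Real.exp y ^ 2 + κ * (Real.exp x * t)))) =
      (Icc n m).indicator (fun y => ENNReal.ofReal (profile n m (Real.exp x) / Real.exp x) *
        ENNReal.ofReal (waveKernel κ (y - x))) y := by
    filter_upwards [hae] with y hy
    have h0 := profile_nonneg n m (Real.exp x)
    rw [lintegral_angular hκ0 hκ hy (mul_nonneg h0 (profile_nonneg _ _ _)), profile_exp n m y]
    by_cases hyI : y ∈ Icc n m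
    · rw [indicator_of_mem hyI, indicator_of_mem hyI, ← ENNReal.ofReal_mul (by positivity),
        ← ENNReal.ofReal_mul (by positivity), ← ENNReal.ofReal_mul (by positivity)]
      -- The Jacobian factors exp y · exp y cancel against the profile exp(-2y): this is the reason
      -- for the power r⁻².
      congr 1
      have := Real.exp_pos y
      field_simp
    · rw [indicator_of_notMem hyI, indicator_of_notMem hyI]
      simp
  rw [lintegral_congr_ae h1, lintegral_indicator measurableSet_Icc,
    lintegral_const_mul' _ _ ENNReal.ofReal_ne_top, ← mul_assoc,
    ← ENNReal.ofReal_mul (by positivity)]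

lemma measurable_lintegral_waveKernel (κ n m : ℝ) :
    Measurable fun x : ℝ => ∫⁻ y in Icc n m, ENNReal.ofReal (waveKernel κ (y - x)) := by
  have h := measurable_waveKernel κ
  exact Measurable.lintegral_prod_right' (f := fun z : ℝ × ℝ =>
    ENNReal.ofReal (waveKernel κ (z.2 - z.1))) (by fun_prop)

/-- Reduction of the double integrals in the charge form to the logarithmic radial variables. -/
lemma lintegral_profile_pair {κ : ℝ} (hκ0 : κ ≠ 0) (hκ : |κ| ≤ 2) (n m : ℝ) :
    ∫⁻ z : R3 × R3, ENNReal.ofReal (profile n m ‖z.1‖ * profile n m ‖z.2‖ /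
        (‖z.1‖ ^ 2 + ‖z.2‖ ^ 2 + κ * inner ℝ z.1 z.2)) =
      ENNReal.ofReal (8 * Real.pi ^ 2) *
        ∫⁻ x in Icc n m, ∫⁻ y in Icc n m, ENNReal.ofReal (waveKernel κ (y - x)) := by
  have hmp := measurable_profile n m
  have hmK := measurable_lintegral_waveKernel κ n m
  rw [Measure.volume_eq_prod, lintegral_prod _ (by fun_prop)]
  have h0 : ∀ᵐ p : R3, p ≠ 0 := by simp [ae_iff]
  have h1 : ∀ᵐ p : R3, ∫⁻ q : R3, ENNReal.ofReal (profile n m ‖p‖ * profile n m ‖q‖ /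
        (‖p‖ ^ 2 + ‖q‖ ^ 2 + κ * inner ℝ p q)) =
      ENNReal.ofReal (2 * Real.pi * (profile n m ‖p‖ / ‖p‖)) *
        ∫⁻ y in Icc n m, ENNReal.ofReal (waveKernel κ (y - Real.log ‖p‖)) := by
    filter_upwards [h0] with p hp
    exact lintegral_profile_inner hκ0 hκ hp
  rw [lintegral_congr_ae h1, lintegral_norm (fun a => ENNReal.ofReal
    (2 * Real.pi * (profile n m a / a)) *
      ∫⁻ y in Icc n m, ENNReal.ofReal (waveKernel κ (y - Real.log a)))
    (Measurable.mul (by fun_prop) (hmK.comp Real.measurable_log))]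
  have h2 : ∀ x : ℝ, ENNReal.ofReal (Real.exp x ^ 3) * (ENNReal.ofReal
      (2 * Real.pi * (profile n m (Real.exp x) / Real.exp x)) *
      ∫⁻ y in Icc n m, ENNReal.ofReal (waveKernel κ (y - Real.log (Real.exp x)))) =
      ENNReal.ofReal (2 * Real.pi) * (Icc n m).indicator (fun x =>
        ∫⁻ y in Icc n m, ENNReal.ofReal (waveKernel κ (y - x))) x := by
    intro x
    rw [Real.log_exp, profile_exp]
    by_cases hx : x ∈ Icc n m
    · rw [indicator_of_mem hx, indicator_of_mem hx, ← mul_assoc,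
        ← ENNReal.ofReal_mul (by positivity)]
      congr 2
      have := Real.exp_pos x
      field_simp
    · rw [indicator_of_notMem hx, indicator_of_notMem hx]
      simp
  simp_rw [h2]
  rw [lintegral_const_mul' _ _ ENNReal.ofReal_ne_top, lintegral_indicator measurableSet_Icc,
    ← mul_assoc, ← ENNReal.ofReal_mul (by positivity)]
  congr 2
  ring

/-- In the variable x = log |p| the integrand exp(3x) · exp x · exp(-4x) is 1 on [n, m]. -/
lemma lintegral_norm_mul_profile_sq (n m : ℝ) :
    ∫⁻ p : R3, ENNReal.ofReal (‖p‖ * profile n m ‖p‖ ^ 2) =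
      ENNReal.ofReal (4 * Real.pi * (m - n)) := by
  have hmp := measurable_profile n m
  rw [lintegral_norm (fun a => ENNReal.ofReal (a * profile n m a ^ 2)) (by fun_prop)]
  have h2 : ∀ x : ℝ, ENNReal.ofReal (Real.exp x ^ 3) *
      ENNReal.ofReal (Real.exp x * profile n m (Real.exp x) ^ 2) =
      (Icc n m).indicator (fun _ => 1) x := by
    intro x
    rw [profile_exp]
    by_cases hx : x ∈ Icc n m
    · rw [indicator_of_mem hx, indicator_of_mem hx, ← ENNReal.ofReal_mul (by positivity),
        ← ENNReal.ofReal_one]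
      congr 1
      have := Real.exp_pos x
      field_simp
    · rw [indicator_of_notMem hx, indicator_of_notMem hx]
      simp
  simp_rw [h2]
  rw [lintegral_indicator measurableSet_Icc, lintegral_const, Measure.restrict_apply
    MeasurableSet.univ, univ_inter, Real.volume_Icc, one_mul,
    ← ENNReal.ofReal_mul (by positivity)]

end Pair

/-! ### The trial charge and bounds on the four terms of the charge form. -/

section Charge

open Set ENNReal

lemma profile_le (n m r : ℝ) : profile n m r ≤ (Real.exp n ^ 2)⁻¹ := by
  rw [profile]
  refine indicator_apply_le' (fun hr => ?_) (fun _ => by positivity)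
  have := Real.exp_pos n
  have := hr.1
  gcongr

lemma profile_eq_zero_of_lt {n m r : ℝ} (h : r < Real.exp n) : profile n m r = 0 :=
  indicator_of_notMem (fun h' => absurd h'.1 (not_le.mpr h)) _

lemma profile_eq_zero_of_gt {n m r : ℝ} (h : Real.exp m < r) : profile n m r = 0 :=
  indicator_of_notMem (fun h' => absurd h'.2 (not_le.mpr h)) _

lemma memLp_of_bounded_of_support {V : Type} [NormedAddCommGroup V] [InnerProductSpace ℝ V]
    [FiniteDimensional ℝ V] [MeasurableSpace V] [BorelSpace V] {E : Type} [NormedAddCommGroup E]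
    {g : V → E} (hg : AEStronglyMeasurable g volume) (C R : ℝ) (hC : ∀ᵐ x, ‖g x‖ ≤ C)
    (hR : ∀ᵐ x, R < ‖x‖ → g x = 0) (p : ℝ≥0∞) : MemLp g p volume := by
  have h := memLp_indicator_const (μ := (volume : Measure V)) p
    (measurableSet_closedBall (x := (0 : V)) (ε := R)) C
    (Or.inr (isCompact_closedBall (0 : V) R).measure_lt_top.ne)
  refine h.of_le hg ?_
  filter_upwards [hC, hR] with x h1 h2
  by_cases hx : x ∈ Metric.closedBall (0 : V) R
  · rw [indicator_of_mem hx]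
    exact h1.trans (le_abs_self C)
  · rw [h2 (by simpa using hx)]
    simp

/-- The Fourier transform of the trial charge. -/
def trialHat (n m : ℝ) (p : R3) : ℂ := (profile n m ‖p‖ : ℂ)

lemma measurable_trialHat (n m : ℝ) : Measurable (trialHat n m) := by
  have := measurable_profile n m
  unfold trialHat
  fun_prop

lemma norm_trialHat (n m : ℝ) (p : R3) : ‖trialHat n m p‖ = profile n m ‖p‖ := by
  rw [trialHat, Complex.norm_real, Real.norm_of_nonneg (profile_nonneg _ _ _)]

lemma memLp_trialHat (n m : ℝ) (p : ℝ≥0∞) : MemLp (trialHat n m) p volume := by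
  refine memLp_of_bounded_of_support (measurable_trialHat n m).aestronglyMeasurable
    (Real.exp n ^ 2)⁻¹ (Real.exp m) (.of_forall fun x => ?_) (.of_forall fun x hx => ?_) p
  · rw [norm_trialHat]
    exact profile_le _ _ _
  · simp [trialHat, profile_eq_zero_of_gt hx]

lemma integrable_profile (n m : ℝ) : Integrable fun p : R3 => profile n m ‖p‖ := by
  have := (memLp_one_iff_integrable.mp (memLp_trialHat n m 1)).norm
  simpa only [norm_trialHat] using this

lemma integrable_profile_sq (n m : ℝ) : Integrable fun p : R3 => profile n m ‖p‖ ^ 2 := by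
  have := (memLp_two_iff_integrable_sq_norm
    (measurable_trialHat n m).aestronglyMeasurable).mp (memLp_trialHat n m 2)
  simpa only [norm_trialHat] using this

/-- Uniform in m: in logarithmic variables the density is exp(-x), integrable at +∞. This keeps all
lower-order terms bounded as the shell grows. -/
lemma integral_profile_sq_le (n m : ℝ) :
    ∫ p : R3, profile n m ‖p‖ ^ 2 ≤ 4 * Real.pi * Real.exp (-n) := by
  have hmp := measurable_profile n m
  rw [integral_eq_lintegral_of_nonneg_ae (.of_forall fun p => by positivity)
    (Measurable.aestronglyMeasurable (by fun_prop))]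
  apply ENNReal.toReal_le_of_le_ofReal (by positivity)
  rw [lintegral_norm (fun a => ENNReal.ofReal (profile n m a ^ 2)) (by fun_prop),
    ENNReal.ofReal_mul (p := 4 * Real.pi) (by positivity)]
  refine mul_le_mul_right ?_ _
  calc ∫⁻ x : ℝ, ENNReal.ofReal (Real.exp x ^ 3) * ENNReal.ofReal (profile n m (Real.exp x) ^ 2)
      ≤ ∫⁻ x in Ici n, ENNReal.ofReal (Real.exp (-x)) := by
        rw [← lintegral_indicator measurableSet_Ici]
        apply lintegral_mono
        intro x
        simp only
        rw [profile_exp]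
        by_cases hx : x ∈ Icc n m
        · rw [indicator_of_mem hx, indicator_of_mem (show x ∈ Ici n from hx.1),
            ← ENNReal.ofReal_mul (by positivity)]
          apply le_of_eq
          congr 1
          rw [Real.exp_neg]
          have := Real.exp_pos x
          field_simp
        · rw [indicator_of_notMem hx]
          simp
    _ = ENNReal.ofReal (Real.exp (-n)) := by
        rw [← setLIntegral_congr Ioi_ae_eq_Ici, ← ofReal_integral_eq_lintegral_ofReal
          (integrableOn_exp_neg_Ioi n) (.of_forall fun x => by positivity), integral_exp_neg_Ioi]

/-- A trial charge with prescribed Fourier transform. -/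
lemma exists_trial_charge (n m : ℝ) :
    ∃ ξ : L2 R3, hat ξ =ᵐ[volume] trialHat n m ∧ ‖ξ‖ ^ 2 = ∫ p : R3, profile n m ‖p‖ ^ 2 ∧
      MemH (1 / 2) ξ := by
  obtain ⟨ξ, h1, h2, h3⟩ := exists_hat_eq (memLp_trialHat n m 2)
  refine ⟨ξ, h1, by simpa only [norm_trialHat] using h2, memH_of_memLp ?_⟩
  have hsupp : ∀ᵐ x, (2 * Real.pi)⁻¹ * Real.exp m < ‖x‖ → (𝓕 ξ : L2 R3) x = 0 := by
    filter_upwards [h3] with x hx hlt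
    rw [hx, trialHat, profile_eq_zero_of_gt]
    · simp
    · rw [norm_smul, Real.norm_of_nonneg (by positivity)]
      rwa [inv_mul_lt_iff₀ (by positivity)] at hlt
  refine memLp_of_bounded_of_support ?_
    ((1 + ((2 * Real.pi)⁻¹ * Real.exp m) ^ 2) ^ (1 / 2 / 2 : ℝ) *
      ((hatConst R3)⁻¹ * (Real.exp n ^ 2)⁻¹)) ((2 * Real.pi)⁻¹ * Real.exp m) ?_ ?_ 2
  · refine AEStronglyMeasurable.mul ?_ (Lp.aestronglyMeasurable _)
    exact Measurable.aestronglyMeasurable (by fun_prop)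
  · filter_upwards [h3, hsupp] with x hx hs
    have hc := hatConst_pos (V := R3)
    by_cases hlt : (2 * Real.pi)⁻¹ * Real.exp m < ‖x‖
    · rw [hs hlt]
      simp only [mul_zero, norm_zero]
      positivity
    · rw [norm_mul, Complex.norm_real, Real.norm_of_nonneg (by positivity)]
      gcongr
      · exact not_lt.mp hlt
      · rw [hx, norm_mul, norm_trialHat, norm_inv, Complex.norm_real, Real.norm_of_nonneg hc.le]
        gcongr
        exact profile_le _ _ _
  · filter_upwards [hsupp] with x hs hlt
    rw [hs hlt, mul_zero]

lemma re_integral_pair {n m : ℝ} {ξ : L2 R3} (hξ : hat ξ =ᵐ[volume] trialHat n m)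
    (D : R3 × R3 → ℝ) :
    (∫ z : R3 × R3, (starRingEnd ℂ) (hat ξ z.1) * hat ξ z.2 / ((D z : ℝ) : ℂ)).re =
      ∫ z : R3 × R3, profile n m ‖z.1‖ * profile n m ‖z.2‖ / D z := by
  rw [← Complex.ofReal_re (∫ z : R3 × R3, profile n m ‖z.1‖ * profile n m ‖z.2‖ / D z),
    ← integral_complex_ofReal]
  congr 1
  apply integral_congr_ae
  have h1 : ∀ᵐ z : R3 × R3, hat ξ z.1 = trialHat n m z.1 :=
    Measure.quasiMeasurePreserving_fst.ae hξ
  have h2 : ∀ᵐ z : R3 × R3, hat ξ z.2 = trialHat n m z.2 :=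
    Measure.quasiMeasurePreserving_snd.ae hξ
  filter_upwards [h1, h2] with z hz1 hz2
  rw [hz1, hz2, trialHat, trialHat, Complex.conj_ofReal]
  push_cast
  rfl

lemma phiDiag_le {n m lam η : ℝ} (hnm : n ≤ m) (hη : 0 ≤ η) (hlam : lam ≤ η * Real.exp n ^ 2)
    {ξ : L2 R3} (hξ : hat ξ =ᵐ[volume] trialHat n m) :
    phiDiag lam ξ ≤ 48 * Real.pi ^ 2 * Real.sqrt (3 / 4 + η) * (m - n) := by
  have hmp := measurable_profile n m
  have key : ∫ p : R3, Real.sqrt (3 / 4 * ‖p‖ ^ 2 + lam) * ‖hat ξ p‖ ^ 2 ≤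
      Real.sqrt (3 / 4 + η) * (4 * Real.pi * (m - n)) := by
    have e : (fun p : R3 => Real.sqrt (3 / 4 * ‖p‖ ^ 2 + lam) * ‖hat ξ p‖ ^ 2) =ᵐ[volume]
        fun p => Real.sqrt (3 / 4 * ‖p‖ ^ 2 + lam) * profile n m ‖p‖ ^ 2 := by
      filter_upwards [hξ] with p hp
      rw [hp, norm_trialHat]
    rw [integral_congr_ae e, integral_eq_lintegral_of_nonneg_ae
      (.of_forall fun p => by positivity) (by fun_prop)]
    apply ENNReal.toReal_le_of_le_ofReal
      (mul_nonneg (by positivity) (mul_nonneg (by positivity) (by linarith)))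
    rw [ENNReal.ofReal_mul (by positivity), ← lintegral_norm_mul_profile_sq,
      ← lintegral_const_mul' _ _ ENNReal.ofReal_ne_top]
    apply lintegral_mono
    intro p
    simp only
    rw [← ENNReal.ofReal_mul (by positivity)]
    apply ENNReal.ofReal_le_ofReal
    rw [← mul_assoc]
    by_cases hp : ‖p‖ < Real.exp n
    · simp [profile_eq_zero_of_lt hp]
    · gcongr
      -- On the shell lam ≤ η exp(2n) ≤ η|p|², so the root is at most √(3/4 + η) · |p|.
      rw [← Real.sqrt_sq (norm_nonneg p), ← Real.sqrt_mul (by positivity),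
        Real.sqrt_sq (norm_nonneg p)]
      apply Real.sqrt_le_sqrt
      have : Real.exp n ^ 2 ≤ ‖p‖ ^ 2 := by
        have := Real.exp_pos n
        have := not_lt.mp hp
        gcongr
      nlinarith
  rw [phiDiag]
  have := mul_le_mul_of_nonneg_left key (show 0 ≤ 12 * Real.pi by positivity)
  linarith

lemma phiReg_le {n m γ : ℝ} (hnm : n ≤ m) {ξ : L2 R3}
    (hξ : hat ξ =ᵐ[volume] trialHat n m) :
    phiReg γ ξ ≤ 24 * Real.pi ^ 3 * max γ 0 * (m - n) := by
  have hmp := measurable_profile n m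
  have h0 : 0 ≤ ∫ z : R3 × R3, profile n m ‖z.1‖ * profile n m ‖z.2‖ / ‖z.1 - z.2‖ ^ 2 :=
    integral_nonneg fun z => div_nonneg
      (mul_nonneg (profile_nonneg _ _ _) (profile_nonneg _ _ _)) (by positivity)
  have h1 : ∫ z : R3 × R3, profile n m ‖z.1‖ * profile n m ‖z.2‖ / ‖z.1 - z.2‖ ^ 2 ≤
      8 * Real.pi ^ 2 * ((m - n) * (Real.pi ^ 2 / 2)) := by
    rw [integral_eq_lintegral_of_nonneg_ae (.of_forall fun z => div_nonneg
      (mul_nonneg (profile_nonneg _ _ _) (profile_nonneg _ _ _)) (by positivity))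
      (Measurable.aestronglyMeasurable (by fun_prop))]
    apply ENNReal.toReal_le_of_le_ofReal
      (mul_nonneg (by positivity) (mul_nonneg (by linarith) (by positivity)))
    have e : ∀ z : R3 × R3, ‖z.1 - z.2‖ ^ 2 =
        ‖z.1‖ ^ 2 + ‖z.2‖ ^ 2 + (-2) * inner ℝ z.1 z.2 := fun z => by
      rw [norm_sub_sq_real]; ring
    simp_rw [e]
    rw [lintegral_profile_pair (by norm_num) (by norm_num),
      ENNReal.ofReal_mul (p := 8 * Real.pi ^ 2) (by positivity)]
    exact mul_le_mul_right (lintegral_waveKernel_box_le hnm) _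
  rw [phiReg, re_integral_pair hξ]
  -- The double integral is nonnegative, so a negative γ may be replaced by 0; this suffices because
  -- γ_c > 0.
  have hγ : 6 * γ / Real.pi ≤ 6 * max γ 0 / Real.pi := by
    gcongr
    exact le_max_left _ _
  calc _ ≤ 6 * max γ 0 / Real.pi * (8 * Real.pi ^ 2 * ((m - n) * (Real.pi ^ 2 / 2))) :=
        mul_le_mul hγ h1 h0 (by positivity)
    _ = _ := by field_simp; ring

lemma phiOff_le {n m M lam η c : ℝ} (hlam : 0 < lam) (hη : 0 ≤ η)
    (hlam' : lam ≤ η * Real.exp n ^ 2)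
    (hM : ENNReal.ofReal ((m - n - 2 * M) * c) ≤
      ∫⁻ x in Icc n m, ∫⁻ y in Icc n m, ENNReal.ofReal (waveKernel 1 (y - x)))
    {ξ : L2 R3} (hξ : hat ξ =ᵐ[volume] trialHat n m) :
    phiOff lam ξ ≤ -(96 * Real.pi * c / (1 + η) * (m - n - 2 * M)) := by
  have hmp := measurable_profile n m
  -- Equivalent to |p + q|² ≥ 0.
  have hD : ∀ z : R3 × R3,
      (‖z.1‖ ^ 2 + ‖z.2‖ ^ 2) / 2 ≤ ‖z.1‖ ^ 2 + ‖z.2‖ ^ 2 + inner ℝ z.1 z.2 := fun z => by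
    have := norm_add_sq_real z.1 z.2
    nlinarith [sq_nonneg ‖z.1 + z.2‖]
  have hI : Integrable fun z : R3 × R3 => profile n m ‖z.1‖ * profile n m ‖z.2‖ /
      (‖z.1‖ ^ 2 + ‖z.2‖ ^ 2 + inner ℝ z.1 z.2 + lam) := by
    have h := ((integrable_profile n m).mul_prod (integrable_profile n m)).div_const lam
    refine h.mono' (Measurable.aestronglyMeasurable (by fun_prop)) (.of_forall fun z => ?_)
    have hp := mul_nonneg (profile_nonneg n m ‖z.1‖) (profile_nonneg n m ‖z.2‖)
    have h2 : lam ≤ ‖z.1‖ ^ 2 + ‖z.2‖ ^ 2 + inner ℝ z.1 z.2 + lam := by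
      nlinarith [hD z, sq_nonneg ‖z.1‖, sq_nonneg ‖z.2‖]
    rw [Real.norm_of_nonneg (div_nonneg hp (hlam.le.trans h2))]
    gcongr
  have key : 8 * Real.pi ^ 2 * ((m - n - 2 * M) * c) / (1 + η) ≤
      ∫ z : R3 × R3, profile n m ‖z.1‖ * profile n m ‖z.2‖ /
        (‖z.1‖ ^ 2 + ‖z.2‖ ^ 2 + inner ℝ z.1 z.2 + lam) := by
    have hnn : ∀ z : R3 × R3, 0 ≤ profile n m ‖z.1‖ * profile n m ‖z.2‖ /
        (‖z.1‖ ^ 2 + ‖z.2‖ ^ 2 + inner ℝ z.1 z.2 + lam) := fun z => by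
      refine div_nonneg (mul_nonneg (profile_nonneg _ _ _) (profile_nonneg _ _ _)) ?_
      nlinarith [hD z, sq_nonneg ‖z.1‖, sq_nonneg ‖z.2‖]
    rw [← ENNReal.ofReal_le_ofReal_iff (integral_nonneg hnn),
      ofReal_integral_eq_lintegral_ofReal hI (.of_forall hnn), div_eq_inv_mul,
      ENNReal.ofReal_mul (by positivity),
      ENNReal.ofReal_mul (p := 8 * Real.pi ^ 2) (by positivity)]
    refine (mul_le_mul_right (mul_le_mul_right hM _) _).trans ?_
    rw [← lintegral_profile_pair one_ne_zero (by norm_num),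
      ← lintegral_const_mul' _ _ ENNReal.ofReal_ne_top]
    apply lintegral_mono
    intro z
    simp only
    rw [← ENNReal.ofReal_mul (by positivity)]
    apply ENNReal.ofReal_le_ofReal
    rw [one_mul]
    by_cases h1 : ‖z.1‖ < Real.exp n
    · simp [profile_eq_zero_of_lt h1]
    by_cases h2 : ‖z.2‖ < Real.exp n
    · simp [profile_eq_zero_of_lt h2]
    have hE := Real.exp_pos n
    have h1' : Real.exp n ^ 2 ≤ ‖z.1‖ ^ 2 := by
      have := not_lt.mp h1
      gcongr
    have h2' : Real.exp n ^ 2 ≤ ‖z.2‖ ^ 2 := by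
      have := not_lt.mp h2
      gcongr
    have hE2 : 0 < Real.exp n ^ 2 := by positivity
    have hDz := hD z
    -- Hence lam is at most η times the denominator at lam = 0, and restoring lam costs at most the
    -- factor 1 + η.
    have hA : Real.exp n ^ 2 ≤ ‖z.1‖ ^ 2 + ‖z.2‖ ^ 2 + inner ℝ z.1 z.2 := by linarith
    rw [← div_eq_inv_mul, div_div]
    apply div_le_div_of_nonneg_left
      (mul_nonneg (profile_nonneg _ _ _) (profile_nonneg _ _ _)) (by linarith)
    nlinarith
  rw [phiOff, re_integral_pair hξ]
  have h := mul_le_mul_of_nonneg_left key (show 0 ≤ 12 / Real.pi by positivity)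
  have e : 12 / Real.pi * (8 * Real.pi ^ 2 * ((m - n - 2 * M) * c) / (1 + η)) =
      96 * Real.pi * c / (1 + η) * (m - n - 2 * M) := by
    field_simp
    ring
  rw [e] at h
  linarith

/-- The profile condition says |θ(s) - 1| ≤ s/b, which cancels the Coulomb singularity. -/
lemma abs_boundedPotential_le {a γ b : ℝ} {θ : ℝ≥0 → ℝ} (hb : 0 < b)
    (hθ : ∀ s : ℝ≥0, 1 - (s : ℝ) / b ≤ θ s ∧ θ s ≤ 1 + (s : ℝ) / b) (y : R3) :
    |boundedPotential a γ θ y| ≤ |1 / a| + |γ| / b := by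
  rw [boundedPotential, neg_div]
  refine (abs_add_le _ _).trans ?_
  rw [abs_neg, abs_mul, div_eq_mul_inv |γ|]
  gcongr
  rw [abs_div, abs_of_nonneg (norm_nonneg y)]
  apply div_le_of_le_mul₀ (norm_nonneg y) (by positivity)
  have h := hθ ‖y‖₊
  rw [coe_nnnorm] at h
  rw [abs_le, inv_mul_eq_div]
  constructor <;> linarith [h.1, h.2]

lemma integrable_norm_sq (ξ : L2 R3) : Integrable fun y => ‖ξ y‖ ^ 2 :=
  (memLp_two_iff_integrable_sq_norm (Lp.aestronglyMeasurable ξ)).mp (Lp.memLp ξ)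

lemma integral_norm_sq (ξ : L2 R3) : ∫ y, ‖ξ y‖ ^ 2 = ‖ξ‖ ^ 2 := by
  rw [← norm_toLp_sq (Lp.memLp ξ), Lp.toLp_coeFn]

lemma phiZero_le {a γ b : ℝ} {θ : ℝ≥0 → ℝ} (hb : 0 < b)
    (hθ : ∀ s : ℝ≥0, 1 - (s : ℝ) / b ≤ θ s ∧ θ s ≤ 1 + (s : ℝ) / b) (ξ : L2 R3) :
    phiZero a γ θ ξ ≤ 12 * Real.pi * ((|1 / a| + |γ| / b) * ‖ξ‖ ^ 2) := by
  rw [phiZero, ← integral_norm_sq, ← integral_const_mul (|1 / a| + |γ| / b)]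
  refine mul_le_mul_of_nonneg_left ?_ (by positivity)
  refine (le_abs_self _).trans ?_
  rw [← Real.norm_eq_abs]
  refine norm_integral_le_of_norm_le ((integrable_norm_sq ξ).const_mul _)
    (.of_forall fun y => ?_)
  rw [norm_mul, Real.norm_eq_abs, norm_pow, norm_norm]
  gcongr
  exact abs_boundedPotential_le hb hθ y

end Charge

/-! ### Bosonic symmetry and L² bound of the potential of the trial charge. -/

section Potential

open Set ENNReal

/-- The linear map of `ℝ⁶ = ℝ³ × ℝ³` given by a real `2 × 2` matrix. -/
def jacobiMap (a b c d : ℝ) : R6 →L[ℝ] R6 :=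
  ((WithLp.prodContinuousLinearEquiv 2 ℝ R3 R3).symm : R3 × R3 →L[ℝ] R6) ∘L
    ((a • ContinuousLinearMap.fst ℝ R3 R3 + b • ContinuousLinearMap.snd ℝ R3 R3).prod
      (c • ContinuousLinearMap.fst ℝ R3 R3 + d • ContinuousLinearMap.snd ℝ R3 R3)) ∘L
    ((WithLp.prodContinuousLinearEquiv 2 ℝ R3 R3) : R6 →L[ℝ] R3 × R3)

lemma jacobiMap_apply (a b c d : ℝ) (z : R6) :
    jacobiMap a b c d z = WithLp.toLp 2 (a • z.fst + b • z.snd, c • z.fst + d • z.snd) := rfl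

@[simp] lemma jacobiMap_fst (a b c d : ℝ) (z : R6) :
    (jacobiMap a b c d z).fst = a • z.fst + b • z.snd := rfl

@[simp] lemma jacobiMap_snd (a b c d : ℝ) (z : R6) :
    (jacobiMap a b c d z).snd = c • z.fst + d • z.snd := rfl

lemma inner_jacobiMap (a b c d : ℝ) (z w : R6) :
    inner ℝ (jacobiMap a b c d z) w = inner ℝ z (jacobiMap a c b d w) := by
  simp only [WithLp.prod_inner_apply]
  change inner ℝ (jacobiMap a b c d z).fst w.fst + inner ℝ (jacobiMap a b c d z).snd w.snd =
    inner ℝ z.fst (jacobiMap a c b d w).fst + inner ℝ z.snd (jacobiMap a c b d w).snd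
  simp only [jacobiMap_fst, jacobiMap_snd, inner_add_left, inner_add_right, inner_smul_left,
    inner_smul_right, conj_trivial]
  ring

lemma jacobiMap_jacobiMap {a b c d : ℝ} (h1 : a * a + b * c = 1) (h2 : a * b + b * d = 0)
    (h3 : c * a + d * c = 0) (h4 : c * b + d * d = 1) (z : R6) :
    jacobiMap a b c d (jacobiMap a b c d z) = z := by
  apply (WithLp.equiv 2 _).injective
  refine Prod.ext ?_ ?_
  · change a • (a • z.fst + b • z.snd) + b • (c • z.fst + d • z.snd) = z.fst
    have e : a • (a • z.fst + b • z.snd) + b • (c • z.fst + d • z.snd) =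
        (a * a + b * c) • z.fst + (a * b + b * d) • z.snd := by module
    rw [e, h1, h2, one_smul, zero_smul, add_zero]
  · change c • (a • z.fst + b • z.snd) + d • (c • z.fst + d • z.snd) = z.snd
    have e : c • (a • z.fst + b • z.snd) + d • (c • z.fst + d • z.snd) =
        (c * a + d * c) • z.fst + (c * b + d * d) • z.snd := by module
    rw [e, h3, h4, one_smul, zero_smul, zero_add]

/-- The exchange of particles `2, 3`. -/
abbrev flipFst : R6 →L[ℝ] R6 := jacobiMap (-1) 0 0 1

/-- The exchange of particles `1, 2` in momentum space. -/
abbrev exchange : R6 →L[ℝ] R6 := jacobiMap (1 / 2) (3 / 4) 1 (-(1 / 2))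

lemma flipFst_flipFst (z : R6) : flipFst (flipFst z) = z :=
  jacobiMap_jacobiMap (by norm_num) (by norm_num) (by norm_num) (by norm_num) z

lemma exchange_exchange (z : R6) : exchange (exchange z) = z :=
  jacobiMap_jacobiMap (by norm_num) (by norm_num) (by norm_num) (by norm_num) z

/-- The symbol of `H₀ + lam`. -/
def freeSymbol (lam : ℝ) (z : R6) : ℝ := ‖z.fst‖ ^ 2 + 3 / 4 * ‖z.snd‖ ^ 2 + lam

lemma freeSymbol_flip (lam : ℝ) (z : R6) : freeSymbol lam (flipFst z) = freeSymbol lam z := by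
  simp [freeSymbol]

lemma freeSymbol_exchange (lam : ℝ) (z : R6) :
    freeSymbol lam (exchange z) = freeSymbol lam z := by
  simp only [freeSymbol, jacobiMap_fst, jacobiMap_snd]
  rw [norm_add_sq_real, norm_add_sq_real]
  simp only [norm_smul, inner_smul_left, inner_smul_right, conj_trivial, mul_pow, Real.norm_eq_abs,
    sq_abs]
  ring

lemma continuous_fst_R6 : Continuous fun z : R6 => z.fst :=
  continuous_fst.comp (WithLp.prod_continuous_ofLp 2 R3 R3)

lemma continuous_snd_R6 : Continuous fun z : R6 => z.snd :=
  continuous_snd.comp (WithLp.prod_continuous_ofLp 2 R3 R3)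

/-- One of the three components of the potential of the trial charge. -/
def component (lam n m : ℝ) (z : R6) : ℂ :=
  ((Real.sqrt (2 / Real.pi) : ℝ) : ℂ) * trialHat n m z.snd / (freeSymbol lam z : ℂ)

/-- The Fourier transform of the potential of the trial charge. -/
def trialPotential (lam n m : ℝ) (z : R6) : ℂ :=
  component lam n m z + component lam n m (exchange z) + component lam n m (exchange (flipFst z))

lemma component_flip (lam n m : ℝ) (z : R6) :
    component lam n m (flipFst z) = component lam n m z := by
  rw [component, component, freeSymbol_flip]
  simp

lemma trialPotential_flip (lam n m : ℝ) (z : R6) :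
    trialPotential lam n m (flipFst z) = trialPotential lam n m z := by
  rw [trialPotential, trialPotential, component_flip, flipFst_flipFst]
  ring

/-- The braid relation of the two transpositions, combined with the invariance of the component
under `flipFst`: the three components form one orbit of the permutation group. -/
lemma component_exchange_flip_exchange (lam n m : ℝ) (z : R6) :
    component lam n m (exchange (flipFst (exchange z))) =
      component lam n m (exchange (flipFst z)) := by
  rw [component, component]
  simp only [freeSymbol_exchange, freeSymbol_flip]
  congr 3
  simp only [jacobiMap_fst, jacobiMap_snd]
  module

lemma trialPotential_exchange (lam n m : ℝ) (z : R6) :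
    trialPotential lam n m (exchange z) = trialPotential lam n m z := by
  rw [trialPotential, trialPotential, component_exchange_flip_exchange, exchange_exchange]
  ring

lemma measurable_component (lam n m : ℝ) : Measurable (component lam n m) := by
  have h1 := continuous_fst_R6.measurable
  have h2 := continuous_snd_R6.measurable
  have h3 := (measurable_trialHat n m).comp h2
  have h4 : Measurable (freeSymbol lam) := by
    unfold freeSymbol
    fun_prop
  unfold component
  exact (measurable_const.mul h3).div (Complex.measurable_ofReal.comp h4)

lemma integrable_resolvent_sq {lam : ℝ} (hlam : 0 < lam) :
    Integrable fun k : R3 => (‖k‖ ^ 2 + lam)⁻¹ ^ 2 := by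
  have h := (integrable_rpow_neg_one_add_norm_sq (E := R3) (μ := volume) (r := 4)
    (by simp; norm_num)).const_mul ((min 1 lam)⁻¹ ^ 2)
  have hmin : 0 < min 1 lam := lt_min one_pos hlam
  refine h.mono' (Measurable.aestronglyMeasurable (by fun_prop)) (.of_forall fun k => ?_)
  have e : ((1 + ‖k‖ ^ 2) ^ (-4 / 2 : ℝ) : ℝ) = (1 + ‖k‖ ^ 2)⁻¹ ^ 2 := by
    rw [inv_pow, show (-4 / 2 : ℝ) = -((2 : ℕ) : ℝ) by norm_num, Real.rpow_neg (by positivity),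
      Real.rpow_natCast]
  rw [e, Real.norm_of_nonneg (by positivity), ← mul_pow, ← mul_inv]
  gcongr
  nlinarith [min_le_left 1 lam, min_le_right 1 lam, sq_nonneg ‖k‖]

/-- Dropping 3/4 |p|² from the denominator separates the variables; the k-integral converges since
its integrand decays like |k|⁻⁴ in dimension 3. -/
lemma component_bound {lam : ℝ} (hlam : 0 < lam) (n m : ℝ) :
    Integrable (fun z => ‖component lam n m z‖ ^ 2) ∧
    ∫ z, ‖component lam n m z‖ ^ 2 ≤
      2 / Real.pi * ((∫ k : R3, (‖k‖ ^ 2 + lam)⁻¹ ^ 2) * ∫ p : R3, profile n m ‖p‖ ^ 2) := by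
  have hprod := ((integrable_resolvent_sq hlam).mul_prod (integrable_profile_sq n m)).const_mul
    (2 / Real.pi)
  have hmp := WithLp.volume_preserving_ofLp R3 R3
  have hemb : MeasurableEmbedding (WithLp.ofLp : R6 → R3 × R3) :=
    (MeasurableEquiv.toLp 2 (R3 × R3)).symm.measurableEmbedding
  have hI : Integrable fun z : R6 => 2 / Real.pi *
      ((‖z.fst‖ ^ 2 + lam)⁻¹ ^ 2 * profile n m ‖z.snd‖ ^ 2) :=
    hmp.integrable_comp_of_integrable hprod
  have hle : ∀ z : R6, ‖component lam n m z‖ ^ 2 ≤ 2 / Real.pi *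
      ((‖z.fst‖ ^ 2 + lam)⁻¹ ^ 2 * profile n m ‖z.snd‖ ^ 2) := by
    intro z
    have hs : 0 < ‖z.fst‖ ^ 2 + lam := by positivity
    have hs' : ‖z.fst‖ ^ 2 + lam ≤ freeSymbol lam z := by
      unfold freeSymbol
      nlinarith [sq_nonneg ‖z.snd‖]
    rw [component, norm_div, norm_mul, Complex.norm_real, Complex.norm_real, norm_trialHat,
      Real.norm_of_nonneg (Real.sqrt_nonneg _), Real.norm_of_nonneg (hs.le.trans hs'), div_pow,
      mul_pow, Real.sq_sqrt (by positivity), div_eq_mul_inv, mul_assoc, ← inv_pow,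
      mul_comm (profile n m ‖z.snd‖ ^ 2)]
    have := hs.trans_le hs'
    gcongr
  have hI' : Integrable (fun z => ‖component lam n m z‖ ^ 2) :=
    hI.mono' ((measurable_component lam n m).norm.pow_const 2).aestronglyMeasurable
      (.of_forall fun z => by rw [Real.norm_of_nonneg (by positivity)]; exact hle z)
  refine ⟨hI', (integral_mono hI' hI hle).trans (le_of_eq ?_)⟩
  rw [integral_const_mul]
  congr 1
  have := hmp.integral_comp hemb (fun w : R3 × R3 =>
    (‖w.1‖ ^ 2 + lam)⁻¹ ^ 2 * profile n m ‖w.2‖ ^ 2)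
  refine this.trans ?_
  rw [Measure.volume_eq_prod, integral_prod_mul (fun k : R3 => (‖k‖ ^ 2 + lam)⁻¹ ^ 2)
    (fun p : R3 => profile n m ‖p‖ ^ 2)]

/-- The three components have equal norms, so |a + b + c|² ≤ 3(|a|² + |b|² + |c|²) gives 9 times the
bound for one. -/
lemma trialPotential_bound {lam : ℝ} (hlam : 0 < lam) (n m : ℝ) :
    MemLp (trialPotential lam n m) 2 volume ∧
    ∫ z, ‖trialPotential lam n m z‖ ^ 2 ≤
      18 / Real.pi * ((∫ k : R3, (‖k‖ ^ 2 + lam)⁻¹ ^ 2) * ∫ p : R3, profile n m ‖p‖ ^ 2) := by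
  obtain ⟨hI, hle⟩ := component_bound hlam n m
  have hme := measurePreserving_of_involutive exchange exchange_exchange
  have hmf := hme.comp (measurePreserving_of_involutive flipFst flipFst_flipFst)
  have hc := measurable_component lam n m
  have hI2 : Integrable (fun z => ‖component lam n m (exchange z)‖ ^ 2) :=
    hme.integrable_comp_of_integrable hI
  have hI3 : Integrable (fun z => ‖component lam n m (exchange (flipFst z))‖ ^ 2) :=
    hmf.integrable_comp_of_integrable hI
  have hemb : MeasurableEmbedding exchange :=
    (involutionEquiv exchange exchange_exchange).toHomeomorph.measurableEmbedding
  have hemb' : MeasurableEmbedding flipFst :=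
    (involutionEquiv flipFst flipFst_flipFst).toHomeomorph.measurableEmbedding
  have e2 : ∫ z, ‖component lam n m (exchange z)‖ ^ 2 = ∫ z, ‖component lam n m z‖ ^ 2 :=
    hme.integral_comp hemb (fun z => ‖component lam n m z‖ ^ 2)
  have e3 : ∫ z, ‖component lam n m (exchange (flipFst z))‖ ^ 2 =
      ∫ z, ‖component lam n m z‖ ^ 2 :=
    hmf.integral_comp (hemb.comp hemb') (fun z => ‖component lam n m z‖ ^ 2)
  have hmeas : Measurable (trialPotential lam n m) :=
    (hc.add (hc.comp hme.measurable)).add (hc.comp hmf.measurable)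
  have hpt : ∀ z, ‖trialPotential lam n m z‖ ^ 2 ≤ 3 * (‖component lam n m z‖ ^ 2 +
      ‖component lam n m (exchange z)‖ ^ 2 + ‖component lam n m (exchange (flipFst z))‖ ^ 2) := by
    intro z
    have h := norm_add₃_le (a := component lam n m z) (b := component lam n m (exchange z))
      (c := component lam n m (exchange (flipFst z)))
    have h' : ‖trialPotential lam n m z‖ ^ 2 ≤ (‖component lam n m z‖ +
        ‖component lam n m (exchange z)‖ + ‖component lam n m (exchange (flipFst z))‖) ^ 2 := by
      rw [trialPotential]
      gcongr
    nlinarith [sq_nonneg (‖component lam n m z‖ - ‖component lam n m (exchange z)‖),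
      sq_nonneg (‖component lam n m z‖ - ‖component lam n m (exchange (flipFst z))‖),
      sq_nonneg (‖component lam n m (exchange z)‖ - ‖component lam n m (exchange (flipFst z))‖)]
  have hI12 : Integrable (fun z => ‖component lam n m z‖ ^ 2 +
      ‖component lam n m (exchange z)‖ ^ 2) := hI.add hI2
  have hIs := (hI12.add hI3).const_mul 3
  have hIT : Integrable (fun z => ‖trialPotential lam n m z‖ ^ 2) :=
    hIs.mono' (hmeas.norm.pow_const 2).aestronglyMeasurable
      (.of_forall fun z => by rw [Real.norm_of_nonneg (by positivity)]; exact hpt z)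
  refine ⟨(memLp_two_iff_integrable_sq_norm hmeas.aestronglyMeasurable).mpr hIT,
    (integral_mono hIT hIs hpt).trans ?_⟩
  rw [integral_const_mul]
  simp only [Pi.add_apply]
  rw [integral_add hI12 hI3, integral_add hI hI2, e2, e3]
  have e : 18 / Real.pi * ((∫ k : R3, (‖k‖ ^ 2 + lam)⁻¹ ^ 2) * ∫ p : R3, profile n m ‖p‖ ^ 2) =
      9 * (2 / Real.pi * ((∫ k : R3, (‖k‖ ^ 2 + lam)⁻¹ ^ 2) *
        ∫ p : R3, profile n m ‖p‖ ^ 2)) := by ring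
  rw [e]
  linarith

lemma potentialHat_ae_eq {lam n m : ℝ} {ξ : L2 R3} (hξ : hat ξ =ᵐ[volume] trialHat n m) :
    potentialHat lam ξ =ᵐ[volume] trialPotential lam n m := by
  have hs : Measure.QuasiMeasurePreserving (fun z : R6 => z.snd) volume volume :=
    Measure.quasiMeasurePreserving_snd.comp
      (WithLp.volume_preserving_ofLp R3 R3).quasiMeasurePreserving
  have hme := measurePreserving_of_involutive exchange exchange_exchange
  have hmf := measurePreserving_of_involutive flipFst flipFst_flipFst
  have h1 : ∀ᵐ z : R6, hat ξ z.snd = trialHat n m z.snd := hs.ae hξ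
  have h2 : ∀ᵐ z : R6, hat ξ (exchange z).snd = trialHat n m (exchange z).snd :=
    hme.quasiMeasurePreserving.ae h1
  have h3 : ∀ᵐ z : R6, hat ξ (exchange (flipFst z)).snd = trialHat n m (exchange (flipFst z)).snd :=
    hmf.quasiMeasurePreserving.ae h2
  filter_upwards [h1, h2, h3] with z hz1 hz2 hz3
  have e2 : z.fst - (1 / 2 : ℝ) • z.snd = (exchange z).snd := by
    simp only [jacobiMap_snd]
    module
  have e3 : -z.fst - (1 / 2 : ℝ) • z.snd = (exchange (flipFst z)).snd := by
    simp only [jacobiMap_snd, jacobiMap_fst]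
    module
  rw [potentialHat, e2, e3, hz1, hz2, hz3, trialPotential, component, component, component,
    freeSymbol_exchange, freeSymbol_exchange, freeSymbol_flip, ← add_div, ← add_div, ← mul_add,
    ← mul_add]
  rfl

lemma isSymmetric_of_hat_ae_eq {lam n m : ℝ} {ψ : L2 R6}
    (hψ : hat ψ =ᵐ[volume] trialPotential lam n m) : IsSymmetric ψ := by
  have hinv : ∀ (T : R6 →L[ℝ] R6) (hT : ∀ z, T (T z) = z)
      (_ : ∀ z, trialPotential lam n m (T z) = trialPotential lam n m z),
      ∀ᵐ z, hat ψ z = hat ψ (T z) := by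
    intro T hT h
    have := (measurePreserving_of_involutive T hT).quasiMeasurePreserving.ae hψ
    filter_upwards [hψ, this] with z h1 h2
    rw [h1, h2, h]
  constructor
  · have := ae_eq_comp_of_hat_ae_eq flipFst flipFst flipFst_flipFst flipFst_flipFst
      (fun x y => inner_jacobiMap _ _ _ _ x y) ψ
      (hinv flipFst flipFst_flipFst (trialPotential_flip lam n m))
    filter_upwards [this] with z hz
    rw [hz, jacobiMap_apply]
    simp
  -- The exchange in position space is the transpose of the exchange in momentum space.
  · have := ae_eq_comp_of_hat_ae_eq (jacobiMap (1 / 2) 1 (3 / 4) (-(1 / 2))) exchange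
      (fun z => jacobiMap_jacobiMap (by norm_num) (by norm_num) (by norm_num) (by norm_num) z)
      exchange_exchange (fun x y => inner_jacobiMap _ _ _ _ x y) ψ
      (hinv exchange exchange_exchange (trialPotential_exchange lam n m))
    filter_upwards [this] with z hz
    rw [hz, jacobiMap_apply]
    simp [sub_eq_add_neg]

/-- A trial state whose regular part vanishes. -/
lemma exists_trial_state {lam : ℝ} (hlam : 0 < lam) (n m : ℝ) {ξ : L2 R3}
    (hξ : hat ξ =ᵐ[volume] trialHat n m) (hH : MemH (1 / 2) ξ) :
    ∃ ψ : L2 R6, IsDecomposition lam ψ 0 ξ ∧ ‖ψ‖ ^ 2 ≤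
      18 / Real.pi * ((∫ k : R3, (‖k‖ ^ 2 + lam)⁻¹ ^ 2) * ∫ p : R3, profile n m ‖p‖ ^ 2) := by
  obtain ⟨hL, hle⟩ := trialPotential_bound hlam n m
  obtain ⟨ψ, h1, h2, -⟩ := exists_hat_eq hL
  refine ⟨ψ, ⟨isSymmetric_of_hat_ae_eq h1, memH_zero 1, hH, ?_⟩, h2.trans_le hle⟩
  filter_upwards [h1, potentialHat_ae_eq (lam := lam) hξ, hat_zero_ae (V := R6)] with z hz1 hz2 hz3
  rw [hz1, hz2, hz3, Pi.zero_apply, zero_add]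

lemma kineticEnergy_zero : kineticEnergy 0 = 0 := by
  rw [kineticEnergy]
  apply integral_eq_zero_of_ae
  filter_upwards [hat_zero_ae (V := R6)] with z hz
  simp [hz]

end Potential

/-! ### The sign of the leading coefficient. -/

section Threshold

lemma gammaC_pos : 0 < gammaC := by
  have h1 : Real.sqrt 3 < 2 := by
    rw [Real.sqrt_lt' (by norm_num)]
    norm_num
  have h2 := Real.pi_gt_three
  have h3 : Real.sqrt 3 / Real.pi < 1 := by
    rw [div_lt_one Real.pi_pos]
    linarith
  rw [gammaC]
  linarith

/-- Below the threshold, the leading coefficient of the charge form on the trial charges is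
negative, with some room to spare. -/
lemma exists_coefficient_neg {γ : ℝ} (hγ : γ < gammaC) :
    ∃ η : ℝ, 0 < η ∧ 48 * Real.pi ^ 2 * Real.sqrt (3 / 4 + η) + 24 * Real.pi ^ 3 * max γ 0 -
      96 * Real.pi * (Real.pi ^ 2 / 3 - η) / (1 + η) < 0 := by
  -- F(0) = 24π³(max γ 0 - γ_c) < 0, and continuity keeps F negative for small η > 0.
  let F : ℝ → ℝ := fun η => 48 * Real.pi ^ 2 * Real.sqrt (3 / 4 + η) +
    24 * Real.pi ^ 3 * max γ 0 - 96 * Real.pi * (Real.pi ^ 2 / 3 - η) / (1 + η)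
  have hF : ContinuousAt F 0 := by
    refine ContinuousAt.sub (by fun_prop) (ContinuousAt.div (by fun_prop) (by fun_prop) (by simp))
  have h0 : F 0 < 0 := by
    have hs : Real.sqrt (3 / 4 + 0) = Real.sqrt 3 / 2 := by
      rw [add_zero, Real.sqrt_div (by norm_num), show (4 : ℝ) = 2 ^ 2 by norm_num,
        Real.sqrt_sq (by norm_num)]
    have hmax : max γ 0 < gammaC := max_lt hγ gammaC_pos
    have e : F 0 = 24 * Real.pi ^ 3 * (max γ 0 - gammaC) := by
      simp only [F]
      rw [hs, gammaC]
      have := Real.pi_ne_zero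
      field_simp
      ring
    rw [e]
    exact mul_neg_of_pos_of_neg (by positivity) (by linarith)
  have h1 : ∀ᶠ η in nhdsWithin (0 : ℝ) (Set.Ioi 0), F η < 0 :=
    (hF.eventually (gt_mem_nhds h0)).filter_mono nhdsWithin_le_nhds
  obtain ⟨η, h2, h3⟩ := (h1.and self_mem_nhdsWithin).exists
  exact ⟨η, h3, h2⟩

end Threshold

/-! ### Conclusion: the shell grows with its inner radius fixed. -/

/-- Below the threshold the quadratic form is unbounded from below. -/
theorem quadraticForm_not_bounded_below {a γ : ℝ} (hγ : γ < gammaC) {θ : ℝ≥0 → ℝ}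
    (hθ : IsProfile θ) {lam : ℝ} (hlam : 0 < lam) :
    ¬ ∃ m : ℝ, ∀ (ψ φ : L2 R6) (ξ : L2 R3), IsDecomposition lam ψ φ ξ →
      m * ‖ψ‖ ^ 2 ≤ quadraticForm a γ θ lam ψ φ ξ := by
  rintro ⟨m₀, hm₀⟩
  obtain ⟨-, -, b, hb, hθb⟩ := hθ
  obtain ⟨η, hη, hneg⟩ := exists_coefficient_neg hγ
  obtain ⟨M, hM0, hM⟩ := exists_le_lintegral_waveKernel_box
    (show Real.pi ^ 2 / 3 - η < Real.pi ^ 2 / 3 by linarith)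
  obtain ⟨n, hn⟩ : ∃ n : ℝ, lam ≤ η * Real.exp n ^ 2 := by
    refine ⟨Real.log (lam / η + 1), ?_⟩
    have h0 : 0 < lam / η := by positivity
    rw [Real.exp_log (by positivity)]
    have h1 : lam = η * (lam / η) := by field_simp
    nlinarith
  set A := 48 * Real.pi ^ 2 * Real.sqrt (3 / 4 + η) + 24 * Real.pi ^ 3 * max γ 0 -
      96 * Real.pi * (Real.pi ^ 2 / 3 - η) / (1 + η) with hA
  set R := ∫ k : R3, (‖k‖ ^ 2 + lam)⁻¹ ^ 2
  have hR : 0 ≤ R := MeasureTheory.integral_nonneg fun k => by positivity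
  set B := 4 * Real.pi * Real.exp (-n)
  set C₁ := |m₀ + lam| * (18 / Real.pi * (R * B))
  set C₂ := 12 * Real.pi * ((|1 / a| + |γ| / b) * B)
  set C₃ := 96 * Real.pi * (Real.pi ^ 2 / 3 - η) / (1 + η) * (2 * M)
  -- The constants do not depend on L: C₁ bounds the norm terms of ψ, C₂ the bounded potential, and
  -- C₃ is the boundary loss of the off-diagonal term.
  have hbound : ∀ L : ℝ, 2 * M ≤ L → 0 ≤ A * L + (C₁ + C₂ + C₃) := by
    intro L hL
    obtain ⟨ξ, hξ, hξn, hξH⟩ := exists_trial_charge n (n + L)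
    obtain ⟨ψ, hψ, hψn⟩ := exists_trial_state hlam n (n + L) hξ hξH
    have hB := integral_profile_sq_le n (n + L)
    have hq := hm₀ ψ 0 ξ hψ
    rw [quadraticForm, kineticEnergy_zero, norm_zero, chargeForm] at hq
    have h1 := phiDiag_le (by linarith) hη.le hn hξ
    have h2 := phiReg_le (γ := γ) (by linarith) hξ
    have h3 := phiOff_le hlam hη.le hn (hM n (n + L) (by linarith)) hξ
    have h4 : phiZero a γ θ ξ ≤ C₂ := by
      refine (phiZero_le hb hθb ξ).trans ?_
      rw [hξn]
      exact mul_le_mul_of_nonneg_left (mul_le_mul_of_nonneg_left hB (by positivity))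
        (by positivity)
    have h5 : -((m₀ + lam) * ‖ψ‖ ^ 2) ≤ C₁ := by
      have h6 : ‖ψ‖ ^ 2 ≤ 18 / Real.pi * (R * B) := hψn.trans (by gcongr)
      have h7 : -((m₀ + lam) * ‖ψ‖ ^ 2) ≤ |m₀ + lam| * ‖ψ‖ ^ 2 := by
        rw [← neg_mul]
        gcongr
        exact neg_le_abs _
      exact h7.trans (mul_le_mul_of_nonneg_left h6 (abs_nonneg _))
    simp only [add_sub_cancel_left] at h1 h2 h3
    have e : A * L + C₃ = 48 * Real.pi ^ 2 * Real.sqrt (3 / 4 + η) * L +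
        24 * Real.pi ^ 3 * max γ 0 * L +
        -(96 * Real.pi * (Real.pi ^ 2 / 3 - η) / (1 + η) * (L - 2 * M)) := by
      ring
    linarith
  -- As A < 0, this L makes A L + C₁ + C₂ + C₃ at most -1.
  have h := hbound (max (2 * M) ((C₁ + C₂ + C₃ + 1) / (-A))) (le_max_left _ _)
  have h' := le_max_right (2 * M) ((C₁ + C₂ + C₃ + 1) / (-A))
  rw [div_le_iff₀ (by linarith)] at h'
  linarith

end ThreeBosons

end

theorem theorem1 (a γ : ℝ) (ha : a ≠ 0) (hγ : γ < ThreeBosons.gammaC)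
    (θ : NNReal → ℝ) (hθ : ThreeBosons.IsProfile θ) (lam : ℝ) (hlam : 0 < lam) :
    ¬ ∃ m : ℝ, ∀ (ψ φ : ThreeBosons.L2 ThreeBosons.R6) (ξ : ThreeBosons.L2 ThreeBosons.R3),
      ThreeBosons.IsDecomposition lam ψ φ ξ →
        m * ‖ψ‖ ^ 2 ≤ ThreeBosons.quadraticForm a γ θ lam ψ φ ξ :=
  ThreeBosons.quadraticForm_not_bounded_below hγ hθ hlam
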